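/- **Setting.** Let $\mathbb K=\mathbb R$ or $\mathbb C$ and $m\ge 1$. A *Nil-algebra of rank $m$* is an associative algebra $\mathscr N=\bigoplus_{i<j}\mathscr N_{ij}$ of strictly upper triangular $m\times m$ matrices with entries $x_{ij}$ in finite-dimensional $\mathbb K$-vector spaces $\mathscr N_{ij}$ carrying non-degenerate symmetric $\mathbb K$-bilinear forms $\langle\cdot,\cdot\rangle$, whose matrix product is given by bilinear maps $\mathscr N_{ij}\times\mathscr N_{jk}\to\mathscr N_{ik}$ with $\langle x_{ij}x_{jk},x_{ij}x_{jk}\rangle=\langle x_{ij},x_{ij}\rangle\langle x_{jk},x_{jk}\rangle$, such that for $i<j$, $x_{ik}\in\mathscr N_{ik}$, $x_{jk}\in\mathscr N_{jk}$: if $\langle x_{ik},\mathscr N x_{jk}\rangle=0$ then $\langle \mathscr N x_{ik},\mathscr N x_{jk}\rangle=0$. Let $\mathbb T(\mathscr N)$ be the space of $m\times m$ matrices with entries in $\mathscr N_{ij}$ above the diagonal, in $\mathbb K$ on it, and in $\mathscr N_{ji}^*$ in position $(i,j)$, $i>j$, below it; write $v^\flat=\langle v,\cdot\rangle$ for $v\in\mathscr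 N_{ij}$, $i<j$, use the same symbol for the inverse identification of $\mathscr N_{ij}^*$ with $\mathscr N_{ij}$, put $c^\flat=c$ for scalars, and let $X^*$ be the transpose of $X^\flat$. The matrix product on $\mathbb T(\mathscr N)$ extends that of $\mathscr N$ and multiplication by scalars through $v\cdot w^\flat=w^\flat\cdot v=\langle v,w\rangle$ for $v,w\in\mathscr N_{ij}$ (products in positions $(i,i)$ and $(j,j)$), $(vw)^\flat=w^\flat v^\flat$, $\langle v_{ij}^\flat v_{ik},v_{jk}\rangle=\langle v_{ik},v_{ij}v_{jk}\rangle$ and $\langle v_{ik}v_{jk}^\flat,v_{ij}\rangle=\langle v_{ik},v_{ij}v_{jk}\rangle$. Let $\mathscr H=\{X\in\mathbb T(\mathscr N): X^*=X\}$. Let $G$ be the group of upper triangular matrices $A=(a_{ij})\in\mathbb T(\mathscr N)$ with all $a_{ii}>0$ if $\mathbb K=\mathbb R$, and all $a_{ii}\neq 0$ if $\mathbb K=\mathbb C$. Put $\det_G A=\prod_i a_{ii}$, $G_0=\{A\in G:\det_GA=1\}$, $G'=\{A\in G: a_{ii}=1\ \forall i\}$. Let $\rho:G\to GL(\mathscr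 H)$ be the representation that integrates the Lie algebra representation $L_A(X)=AX+XA^*$; explicitly $\rho_A(B+B^*)=(AB)A^*+A(AB)^*$ for upper triangular $B$. Let $\mathscr V=\{AA^*: A\in G\}\subset\mathscr H$ be the Vinberg cone. The *matrix coordinates* of $X=(x_{ij})\in\mathscr H$ are the $x_{ii}$ and the coordinates of the $x_{ij}$, $i<j$, in fixed bases of the $\mathscr N_{ij}$. For $X=AA^*\in\mathscr V$ put $a_{ii}^2(X)=a_{ii}^2$ and $\pi^2(X)=\prod_i a_{ii}^2(X)=(\det_GA)^2$. The Vinberg–Koszul characteristic function is $\chi(AA^*)=1/\det\rho_A$; if $\mathbb K=\mathbb R$ it is a function on $\mathscr V$, if $\mathbb K=\mathbb C$ it is in general multivalued, its values at $X$ being all the numbers $1/\det\rho_A$ with $A\in G$, $AA^*=X$ (they agree up to sign). **Lemma 3.1.** The functions $a_{ii}^2(X)$ are well defined on $\mathscr V$ and $G'$-invariant (that is, invariant under $\rho_A$, $A\in G'$). There exist polynomials $p_1,\dots,p_m$ in the matrix coordinates, with $p_i$ homogeneous of degree $2^{m-i}$, nowhere zero on $\mathscr V$, such that for all $X\in\mathscr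 V$ and all $i$ $$a_{ii}^2(X)=\frac{p_i(X)}{\prod_{s>i}p_s(X)} .$$ In particular, each $a_{ii}^2$ is a homogeneous rational function of degree $1$ in the matrix coordinates. Moreover: (i) $\pi^2$ is a $G_0$-invariant homogeneous rational function of degree $m$ in the matrix coordinates, and extends as a rational function to $\mathscr H$ by $$\pi^2(X)=\prod_{i=1}^m p_i(X)^{2-i}=\frac{p_1(X)}{\prod_{\ell\ge3}p_\ell(X)^{\ell-2}} .$$ (ii) Let $n_i=1+\tfrac12\sum_{s\ne i}\dim\mathscr N_{is}$, where $\dim\mathscr N_{is}=\dim\mathscr N_{si}$ for $s<i$. If $\mathbb K=\mathbb R$, then $p_i>0$ on $\mathscr V$ and $$\chi(X)=\prod_{i=1}^m p_i(X)^{-(n_i-n_{i-1}-\cdots-n_1)}\qquad(X\in\mathscr V).$$ If $\mathbb K=\mathbb C$, the same formula holds as an equality of multivalued functions: the values of $\chi$ at $X\in\mathscr V$ are exactly the numbers $\prod_i r_i^{-2(n_i-n_{i-1}-\cdots-n_1)}$, where $(r_1,\dots,r_m)$ runs over all choices of square roots $r_i^2=p_i(X)$. -/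

import Mathlib

open scoped BigOperators

universe u v w

/-- A Nil-algebra of rank `m` over `K = ℝ` or `ℂ`: the algebra of strictly upper triangular `m × m`
matrices with entries in the metric vector spaces `N i j`, `i < j`. To have uniform formulas, `N i j`
is given for all `i, j` and is required to be zero unless `i < j`. The inner products are
`K`-bilinear, symmetric and nondegenerate, not necessarily definite. -/
structure NilAlgebra (K : Type v) [RCLike K] (m : ℕ) where
  N : Fin m → Fin m → Type u
  [acg : ∀ i j, AddCommGroup (N i j)]
  [mod : ∀ i j, Module K (N i j)]
  [fin : ∀ i j, FiniteDimensional K (N i j)]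
  upper : ∀ i j, ¬ i < j → Subsingleton (N i j)
  /-- the inner product of `N i j` -/
  form : ∀ i j, LinearMap.BilinForm K (N i j)
  form_symm : ∀ i j, ∀ x y : N i j, form i j x y = form i j y x
  form_nondeg : ∀ i j, (form i j).Nondegenerate
  /-- the products of entries -/
  mul : ∀ i j k, N i j →ₗ[K] N j k →ₗ[K] N i k
  assoc : ∀ i j k l, ∀ (x : N i j) (y : N j k) (z : N k l),
    mul i k l (mul i j k x y) z = mul i j l x (mul j k l y z)
  isometric : ∀ i j k, ∀ (x : N i j) (y : N j k),
    form i k (mul i j k x y) (mul i j k x y) = form i j x x * form j k y y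
  orthogonal : ∀ i j k, i < j → ∀ (x : N i k) (y : N j k),
    (∀ z : N i j, form i k x (mul i j k z y) = 0) →
      ∀ h, ∀ (s : N h i) (t : N h j), form h k (mul h i k s x) (mul h j k t y) = 0

attribute [instance] NilAlgebra.acg NilAlgebra.mod NilAlgebra.fin

namespace NilAlgebra

noncomputable section

variable {K : Type v} [RCLike K] {m : ℕ} (𝒩 : NilAlgebra.{u, v} K m)

/-! ### The Vinberg T-algebra -/

/-- The space of all `m × m` matrices with entries in `N i j` above the diagonal, in `K` on the
diagonal and in the dual spaces below it: `M = (d, u, l)` has diagonal entries `d i`, the entry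
`u i j ∈ N i j` in position `(i, j)`, `i < j`, and in position `(j, i)` the covector `⟨l i j, ·⟩`,
which is recorded by the vector `l i j ∈ N i j`. -/
abbrev TAlg : Type (max u v) :=
  (Fin m → K) × ((i j : Fin m) → 𝒩.N i j) × ((i j : Fin m) → 𝒩.N i j)

variable {𝒩}

/-- The diagonal entries. -/
def TAlg.d (X : 𝒩.TAlg) (i : Fin m) : K := X.1 i

/-- The entries above the diagonal. -/
def TAlg.u (X : 𝒩.TAlg) (i j : Fin m) : 𝒩.N i j := X.2.1 i j

/-- The entries below the diagonal, recorded as vectors. -/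
def TAlg.l (X : 𝒩.TAlg) (i j : Fin m) : 𝒩.N i j := X.2.2 i j

namespace TAlg

theorem ext {X Y : 𝒩.TAlg} (hd : ∀ i, X.d i = Y.d i) (hu : ∀ i j, X.u i j = Y.u i j)
    (hl : ∀ i j, X.l i j = Y.l i j) : X = Y :=
  Prod.ext (funext hd) (Prod.ext (funext fun i => funext (hu i)) (funext fun i => funext (hl i)))

@[simp] theorem d_add (X Y : 𝒩.TAlg) (i : Fin m) : (X + Y).d i = X.d i + Y.d i := rfl
@[simp] theorem u_add (X Y : 𝒩.TAlg) (i j : Fin m) : (X + Y).u i j = X.u i j + Y.u i j := rfl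
@[simp] theorem l_add (X Y : 𝒩.TAlg) (i j : Fin m) : (X + Y).l i j = X.l i j + Y.l i j := rfl
@[simp] theorem d_smul (c : K) (X : 𝒩.TAlg) (i : Fin m) : (c • X).d i = c * X.d i := rfl
@[simp] theorem u_smul (c : K) (X : 𝒩.TAlg) (i j : Fin m) : (c • X).u i j = c • X.u i j := rfl
@[simp] theorem l_smul (c : K) (X : 𝒩.TAlg) (i j : Fin m) : (c • X).l i j = c • X.l i j := rfl
@[simp] theorem d_mk (a : Fin m → K) (b c : (i j : Fin m) → 𝒩.N i j) (i : Fin m) :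
    TAlg.d (𝒩 := 𝒩) (a, b, c) i = a i := rfl
@[simp] theorem u_mk (a : Fin m → K) (b c : (i j : Fin m) → 𝒩.N i j) (i j : Fin m) :
    TAlg.u (𝒩 := 𝒩) (a, b, c) i j = b i j := rfl
@[simp] theorem l_mk (a : Fin m → K) (b c : (i j : Fin m) → 𝒩.N i j) (i j : Fin m) :
    TAlg.l (𝒩 := 𝒩) (a, b, c) i j = c i j := rfl

end TAlg

variable (𝒩)

/-- The product `x♭ · y` of `x ∈ N i j` and `y ∈ N i k`: the vector of `N j k` with
`⟨x♭ · y, z⟩ = ⟨y, x · z⟩` for all `z ∈ N j k`. -/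
def flatMul (i j k : Fin m) (x : 𝒩.N i j) (y : 𝒩.N i k) : 𝒩.N j k :=
  ((𝒩.form j k).toDual (𝒩.form_nondeg j k)).symm ((𝒩.form i k y).comp (𝒩.mul i j k x))

/-- The product `x · y♭` of `x ∈ N i k` and `y ∈ N j k`: the vector of `N i j` with
`⟨x · y♭, z⟩ = ⟨x, z · y⟩` for all `z ∈ N i j`. -/
def mulFlat (i j k : Fin m) (x : 𝒩.N i k) (y : 𝒩.N j k) : 𝒩.N i j :=
  ((𝒩.form i j).toDual (𝒩.form_nondeg i j)).symm ((𝒩.form i k x).comp ((𝒩.mul i j k).flip y))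

variable {𝒩}

theorem form_flatMul (i j k : Fin m) (x : 𝒩.N i j) (y : 𝒩.N i k) (z : 𝒩.N j k) :
    𝒩.form j k (𝒩.flatMul i j k x y) z = 𝒩.form i k y (𝒩.mul i j k x z) := by
  simp [flatMul, LinearMap.BilinForm.apply_toDual_symm_apply]

theorem form_mulFlat (i j k : Fin m) (x : 𝒩.N i k) (y : 𝒩.N j k) (z : 𝒩.N i j) :
    𝒩.form i j (𝒩.mulFlat i j k x y) z = 𝒩.form i k x (𝒩.mul i j k z y) := by
  simp [mulFlat, LinearMap.BilinForm.apply_toDual_symm_apply]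

theorem flatMul_add_left (i j k : Fin m) (x x' : 𝒩.N i j) (y : 𝒩.N i k) :
    𝒩.flatMul i j k (x + x') y = 𝒩.flatMul i j k x y + 𝒩.flatMul i j k x' y := by
  simp [flatMul, LinearMap.comp_add]

theorem flatMul_add_right (i j k : Fin m) (x : 𝒩.N i j) (y y' : 𝒩.N i k) :
    𝒩.flatMul i j k x (y + y') = 𝒩.flatMul i j k x y + 𝒩.flatMul i j k x y' := by
  simp [flatMul, LinearMap.add_comp]

theorem flatMul_smul_left (i j k : Fin m) (c : K) (x : 𝒩.N i j) (y : 𝒩.N i k) :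
    𝒩.flatMul i j k (c • x) y = c • 𝒩.flatMul i j k x y := by
  simp [flatMul, LinearMap.comp_smul]

theorem flatMul_smul_right (i j k : Fin m) (c : K) (x : 𝒩.N i j) (y : 𝒩.N i k) :
    𝒩.flatMul i j k x (c • y) = c • 𝒩.flatMul i j k x y := by
  simp [flatMul, LinearMap.smul_comp]

theorem mulFlat_add_left (i j k : Fin m) (x x' : 𝒩.N i k) (y : 𝒩.N j k) :
    𝒩.mulFlat i j k (x + x') y = 𝒩.mulFlat i j k x y + 𝒩.mulFlat i j k x' y := by
  simp [mulFlat, LinearMap.add_comp]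

theorem mulFlat_add_right (i j k : Fin m) (x : 𝒩.N i k) (y y' : 𝒩.N j k) :
    𝒩.mulFlat i j k x (y + y') = 𝒩.mulFlat i j k x y + 𝒩.mulFlat i j k x y' := by
  simp [mulFlat, LinearMap.comp_add]

theorem mulFlat_smul_left (i j k : Fin m) (c : K) (x : 𝒩.N i k) (y : 𝒩.N j k) :
    𝒩.mulFlat i j k (c • x) y = c • 𝒩.mulFlat i j k x y := by
  simp [mulFlat, LinearMap.smul_comp]

theorem mulFlat_smul_right (i j k : Fin m) (c : K) (x : 𝒩.N i k) (y : 𝒩.N j k) :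
    𝒩.mulFlat i j k x (c • y) = c • 𝒩.mulFlat i j k x y := by
  simp [mulFlat, LinearMap.comp_smul]

/-- The diagonal entries of the product `X · Y`. -/
def mulD (X Y : 𝒩.TAlg) (i : Fin m) : K :=
  X.d i * Y.d i + ∑ k, 𝒩.form i k (X.u i k) (Y.l i k) + ∑ k, 𝒩.form k i (X.l k i) (Y.u k i)

/-- The entries of the product `X · Y` above the diagonal: the sum over `k` of the products of the
entry of `X` in position `(i, k)` and the entry of `Y` in position `(k, j)`, for `k = i`, `k = j`,
`i < k < j`, `k < i` and `j < k`. -/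
def mulU (X Y : 𝒩.TAlg) (i j : Fin m) : 𝒩.N i j :=
  X.d i • Y.u i j + Y.d j • X.u i j + ∑ k, 𝒩.mul i k j (X.u i k) (Y.u k j)
    + ∑ k, 𝒩.flatMul k i j (X.l k i) (Y.u k j) + ∑ k, 𝒩.mulFlat i j k (X.u i k) (Y.l j k)

variable (𝒩)

/-- The matrix `X* = t(X♭)`. -/
def adj : 𝒩.TAlg →ₗ[K] 𝒩.TAlg where
  toFun X := (X.d, X.l, X.u)
  map_add' _ _ := rfl
  map_smul' _ _ := rfl

variable {𝒩}

@[simp] theorem d_adj (X : 𝒩.TAlg) (i : Fin m) : (𝒩.adj X).d i = X.d i := rfl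
@[simp] theorem u_adj (X : 𝒩.TAlg) (i j : Fin m) : (𝒩.adj X).u i j = X.l i j := rfl
@[simp] theorem l_adj (X : 𝒩.TAlg) (i j : Fin m) : (𝒩.adj X).l i j = X.u i j := rfl
@[simp] theorem adj_adj (X : 𝒩.TAlg) : 𝒩.adj (𝒩.adj X) = X := rfl

theorem mulD_add_left (X X' Y : 𝒩.TAlg) (i : Fin m) :
    mulD (X + X') Y i = mulD X Y i + mulD X' Y i := by
  simp [mulD, Finset.sum_add_distrib]; ring

theorem mulD_add_right (X Y Y' : 𝒩.TAlg) (i : Fin m) :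
    mulD X (Y + Y') i = mulD X Y i + mulD X Y' i := by
  simp [mulD, Finset.sum_add_distrib]; ring

theorem mulD_smul_left (c : K) (X Y : 𝒩.TAlg) (i : Fin m) :
    mulD (c • X) Y i = c * mulD X Y i := by
  simp [mulD]; ring_nf; simp [Finset.mul_sum]

theorem mulD_smul_right (c : K) (X Y : 𝒩.TAlg) (i : Fin m) :
    mulD X (c • Y) i = c * mulD X Y i := by
  simp [mulD]; ring_nf; simp [Finset.mul_sum]

theorem mulU_add_left (X X' Y : 𝒩.TAlg) (i j : Fin m) :
    mulU (X + X') Y i j = mulU X Y i j + mulU X' Y i j := by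
  simp [mulU, Finset.sum_add_distrib, flatMul_add_left, mulFlat_add_left, add_smul]; abel

theorem mulU_add_right (X Y Y' : 𝒩.TAlg) (i j : Fin m) :
    mulU X (Y + Y') i j = mulU X Y i j + mulU X Y' i j := by
  simp [mulU, Finset.sum_add_distrib, flatMul_add_right, mulFlat_add_right, add_smul]; abel

theorem mulU_smul_left (c : K) (X Y : 𝒩.TAlg) (i j : Fin m) :
    mulU (c • X) Y i j = c • mulU X Y i j := by
  simp [mulU, Finset.smul_sum, flatMul_smul_left, mulFlat_smul_left, mul_smul, smul_comm c]

theorem mulU_smul_right (c : K) (X Y : 𝒩.TAlg) (i j : Fin m) :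
    mulU X (c • Y) i j = c • mulU X Y i j := by
  simp [mulU, Finset.smul_sum, flatMul_smul_right, mulFlat_smul_right, mul_smul, smul_comm c]

variable (𝒩)

/-- The (in general non-associative) matrix product of the T-algebra; the entries below the diagonal
are given by the rule `(x · y)♭ = y♭ · x♭`. -/
def tmul : 𝒩.TAlg →ₗ[K] 𝒩.TAlg →ₗ[K] 𝒩.TAlg :=
  LinearMap.mk₂ K (fun X Y => (mulD X Y, mulU X Y, mulU (𝒩.adj Y) (𝒩.adj X)))
    (fun X X' Y => TAlg.ext (mulD_add_left X X' Y) (mulU_add_left X X' Y)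
      (fun i j => by simp [mulU_add_right]))
    (fun c X Y => TAlg.ext (mulD_smul_left c X Y) (mulU_smul_left c X Y)
      (fun i j => by simp [mulU_smul_right]))
    (fun X Y Y' => TAlg.ext (mulD_add_right X Y Y') (mulU_add_right X Y Y')
      (fun i j => by simp [mulU_add_left]))
    (fun c X Y => TAlg.ext (mulD_smul_right c X Y) (mulU_smul_right c X Y)
      (fun i j => by simp [mulU_smul_left]))

variable {𝒩}

theorem adj_tmul (X Y : 𝒩.TAlg) : 𝒩.adj (𝒩.tmul X Y) = 𝒩.tmul (𝒩.adj Y) (𝒩.adj X) := by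
  refine TAlg.ext (fun i => ?_) (fun _ _ => rfl) (fun _ _ => rfl)
  change mulD X Y i = mulD (𝒩.adj Y) (𝒩.adj X) i
  simp only [mulD, d_adj, u_adj, l_adj]
  rw [mul_comm, Finset.sum_congr rfl fun k _ => 𝒩.form_symm i k (X.u i k) (Y.l i k),
    Finset.sum_congr rfl fun k _ => 𝒩.form_symm k i (X.l k i) (Y.u k i)]

variable (𝒩)

/-- The identity matrix. -/
def one : 𝒩.TAlg := (fun _ => 1, 0, 0)

/-- The Solv-algebra of upper triangular matrices `D + N`; as a vector space it is also the Lie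
algebra of the Vinberg group. -/
def solv : Submodule K 𝒩.TAlg where
  carrier := {A | ∀ i j, A.l i j = 0}
  zero_mem' _ _ := rfl
  add_mem' ha hb i j := by simp [ha i j, hb i j]
  smul_mem' c _ ha i j := by simp [ha i j]

/-- The space `Herm` of Hermitian matrices, `X* = X`. -/
def herm : Submodule K 𝒩.TAlg where
  carrier := {X | 𝒩.adj X = X}
  zero_mem' := map_zero _
  add_mem' {a b} ha hb := by
    change 𝒩.adj (a + b) = a + b
    rw [map_add, ha, hb]
  smul_mem' c a ha := by
    change 𝒩.adj (c • a) = c • a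
    rw [map_smul, ha]

/-! ### The Vinberg group, its action on Hermitian matrices and the cone -/

variable (K) in
/-- The identity component of the multiplicative group of `K`: the positive numbers if `K = ℝ` (the
case in which the imaginary unit `RCLike.I` is `0`), all nonzero numbers if `K = ℂ`. -/
def unitComponent : Set K := {z | z ≠ 0 ∧ ((RCLike.I : K) = 0 → 0 < RCLike.re z)}

/-- The Vinberg group `G`: upper triangular matrices with positive (if `K = ℝ`) or nonzero (if
`K = ℂ`) diagonal entries. -/
def G : Set 𝒩.TAlg := {A | A ∈ 𝒩.solv ∧ ∀ i, A.d i ∈ unitComponent K}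

variable {𝒩} in
/-- The `G`-determinant. -/
def detG (A : 𝒩.TAlg) : K := ∏ i, A.d i

/-- The unimodular subgroup `G₀`. -/
def G₀ : Set 𝒩.TAlg := {A | A ∈ 𝒩.G ∧ detG A = 1}

/-- The unipotent radical `G'`. -/
def G' : Set 𝒩.TAlg := {A | A ∈ 𝒩.G ∧ ∀ i, A.d i = 1}

variable {𝒩} in
/-- The Lie algebra representation `L_A(X) = A · X + X · A*`. -/
def lieAction (A X : 𝒩.TAlg) : 𝒩.TAlg := 𝒩.tmul A X + 𝒩.tmul X (𝒩.adj A)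

/-- For a Hermitian matrix `X = N* + D + N`, the upper triangular matrix `B = D/2 + N`, so that
`X = B + B*`. -/
def upperHalf : 𝒩.TAlg →ₗ[K] 𝒩.TAlg where
  toFun X := ((fun i => (2 : K)⁻¹ * X.d i), X.u, 0)
  map_add' X Y := TAlg.ext (fun i => by simp [mul_add]) (fun _ _ => rfl) (fun i j => by simp)
  map_smul' c X := TAlg.ext (fun i => by simp; ring) (fun _ _ => rfl) (fun i j => by simp)

theorem upperHalf_add_adj (X : 𝒩.herm) :
    𝒩.upperHalf X + 𝒩.adj (𝒩.upperHalf X) = (X : 𝒩.TAlg) := by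
  have hX : 𝒩.adj (X : 𝒩.TAlg) = X := X.2
  refine TAlg.ext (fun i => ?_) (fun i j => ?_) (fun i j => ?_)
  · change (2 : K)⁻¹ * (X : 𝒩.TAlg).d i + (2 : K)⁻¹ * (X : 𝒩.TAlg).d i = _
    ring
  · change (X : 𝒩.TAlg).u i j + 0 = _
    simp
  · change 0 + (X : 𝒩.TAlg).u i j = _
    rw [zero_add, ← l_adj, hX]

variable {𝒩}

/-- The action `ρ_A` of `A ∈ G` on Hermitian matrices, which integrates the Lie algebra
representation `L`. For `X = B + B*` with `B` upper triangular,
`ρ_A(X) = (A · B) · A* + A · (A · B)*`. -/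
def action (A : 𝒩.TAlg) : 𝒩.herm →ₗ[K] 𝒩.herm :=
  LinearMap.codRestrict 𝒩.herm
    (((𝒩.tmul.flip (𝒩.adj A) ∘ₗ 𝒩.tmul A) + (𝒩.tmul A ∘ₗ 𝒩.adj ∘ₗ 𝒩.tmul A))
      ∘ₗ 𝒩.upperHalf ∘ₗ 𝒩.herm.subtype)
    (by
      intro X
      change 𝒩.adj (𝒩.tmul (𝒩.tmul A (𝒩.upperHalf X)) (𝒩.adj A)
          + 𝒩.tmul A (𝒩.adj (𝒩.tmul A (𝒩.upperHalf X))))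
        = 𝒩.tmul (𝒩.tmul A (𝒩.upperHalf X)) (𝒩.adj A)
          + 𝒩.tmul A (𝒩.adj (𝒩.tmul A (𝒩.upperHalf X)))
      rw [map_add, adj_tmul, adj_tmul A (𝒩.adj _), adj_adj, adj_adj, add_comm])

theorem action_apply (A : 𝒩.TAlg) (X : 𝒩.herm) :
    (action A X : 𝒩.TAlg) = 𝒩.tmul (𝒩.tmul A (𝒩.upperHalf X)) (𝒩.adj A)
      + 𝒩.tmul A (𝒩.adj (𝒩.tmul A (𝒩.upperHalf X))) := rfl

variable (𝒩)

/-- `ρ` is a linear representation of the group `G` on `Herm` with differential `L` at the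
identity. (Derivatives in the finite-dimensional space `Herm` are taken through linear
functionals.) -/
def IntegratesLieAction (ρ : 𝒩.TAlg → (𝒩.herm →ₗ[K] 𝒩.herm)) : Prop :=
  ρ 𝒩.one = LinearMap.id ∧
  (∀ A ∈ 𝒩.G, ∀ B ∈ 𝒩.G, 𝒩.tmul A B ∈ 𝒩.G ∧ ρ (𝒩.tmul A B) = ρ A ∘ₗ ρ B) ∧
  ∀ A ∈ 𝒩.solv, ∀ X : 𝒩.herm, ∀ φ : Module.Dual K 𝒩.TAlg,
    HasDerivAt (fun t : K => φ (ρ (𝒩.one + t • A) X)) (φ (lieAction A X)) 0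

/-- The relation `X = A · A*` with `A ∈ G`. -/
def IsFactor (A : 𝒩.TAlg) (X : 𝒩.herm) : Prop :=
  A ∈ 𝒩.G ∧ (X : 𝒩.TAlg) = 𝒩.tmul A (𝒩.adj A)

/-- The Vinberg cone `V = {A · A* : A ∈ G}`. -/
def cone : Set 𝒩.herm := {X | ∃ A, 𝒩.IsFactor A X}

/-! ### Functions on the cone -/

variable {𝒩}

open Classical in
/-- The squares `a_{ii}(X)²` of the diagonal group coordinates of a point `X = A · A*` of the cone
(for one choice of `A ∈ G`; zero outside the cone). -/
def diagSq (X : 𝒩.herm) (i : Fin m) : K :=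
  if h : ∃ A, 𝒩.IsFactor A X then (h.choose.d i) ^ 2 else 0

/-- The squared `G`-determinant `π²(X)`. -/
def piSq (X : 𝒩.herm) : K := ∏ i, diagSq X i

/-- The values at `X` of the Vinberg-Koszul characteristic function `χ(A · A*) = 1 / det ρ_A`: the
set of all `1 / det ρ_A` with `A ∈ G`, `X = A · A*`. (If `K = ℂ` then `A` is determined only up to
the signs of its columns and `χ` only up to a sign.) -/
def charValues (X : 𝒩.herm) : Set K :=
  {c | ∃ A, 𝒩.IsFactor A X ∧ c = (LinearMap.det (action A))⁻¹}

variable (𝒩)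

/-- The number `nᵢ = 1 + ½ ∑_{s ≠ i} dim N_{is}`, where `N_{is}` is the dual of `N_{si}` if `s < i`;
recall that `N i s` is zero unless `i < s`. -/
def n (i : Fin m) : ℝ :=
  1 + 1 / 2 * ∑ s ∈ Finset.univ.erase i,
    ((Module.finrank K (𝒩.N i s) : ℝ) + Module.finrank K (𝒩.N s i))

/-- The integer `2 nᵢ`. -/
def twoN (i : Fin m) : ℤ :=
  2 + ∑ s ∈ Finset.univ.erase i,
    ((Module.finrank K (𝒩.N i s) : ℤ) + Module.finrank K (𝒩.N s i))

theorem twoN_eq (i : Fin m) : (𝒩.twoN i : ℝ) = 2 * 𝒩.n i := by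
  simp only [twoN, n]
  push_cast
  ring

/-! ### Matrix coordinates, polynomials and rational functions -/

variable {𝒩}

/-- The index set of the matrix coordinates of a Hermitian matrix: `m` diagonal entries and, for all
`i < j`, the coordinates of the `(i, j)`-entry in a basis of `N i j`. -/
abbrev CoordIndex {m : ℕ} (ι : Fin m → Fin m → Type w) : Type w :=
  Fin m ⊕ (Σ i j : Fin m, ι i j)

/-- The matrix coordinates of a Hermitian matrix. -/
def coords {ι : Fin m → Fin m → Type w} (b : ∀ i j, Module.Basis (ι i j) K (𝒩.N i j))
    (X : 𝒩.herm) : CoordIndex ι → K :=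
  Sum.elim (fun i => (X : 𝒩.TAlg).d i) (fun s => (b s.1 s.2.1).repr ((X : 𝒩.TAlg).u s.1 s.2.1) s.2.2)

/-- The field of rational functions in the variables indexed by `σ`. -/
abbrev RatFun (σ : Type w) (K : Type v) [Field K] : Type (max w v) :=
  FractionRing (MvPolynomial σ K)

/-- A rational function is homogeneous of degree `d` if it is a quotient of homogeneous polynomials
whose degrees differ by `d`. -/
def IsHomogeneousRat {σ : Type w} (f : RatFun σ K) (d : ℤ) : Prop :=
  ∃ (P Q : MvPolynomial σ K) (a b : ℕ), P.IsHomogeneous a ∧ Q.IsHomogeneous b ∧ Q ≠ 0 ∧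
    (a : ℤ) - b = d ∧
    f = algebraMap (MvPolynomial σ K) (RatFun σ K) P / algebraMap (MvPolynomial σ K) (RatFun σ K) Q

/-- The rational function `f` is defined at the point `x` and has the value `c` there. -/
def HasValueAt {σ : Type w} (f : RatFun σ K) (x : σ → K) (c : K) : Prop :=
  ∃ P Q : MvPolynomial σ K, MvPolynomial.eval x Q ≠ 0 ∧
    f = algebraMap (MvPolynomial σ K) (RatFun σ K) P / algebraMap (MvPolynomial σ K) (RatFun σ K) Q ∧
    c = MvPolynomial.eval x P / MvPolynomial.eval x Q

end

end NilAlgebra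

namespace NilAlgebra

/-! ### Nil-algebra identities, and the representation of the Vinberg group. -/

section Algebra

variable {K : Type v} [RCLike K] {m : ℕ} {𝒩 : NilAlgebra.{u, v} K m}

/-! The T-algebra is not associative, but two facts replace associativity. Upper triangular matrices
do multiply associatively, and the orthogonality axiom amounts to the weak law `(a x) y♭ = a (x y♭)`
(`form_mul_mul_of_lt`). Under the pairing of upper triangular parts, right multiplication by `B*` is
adjoint to right multiplication by `B` (`pair_tmul_adj`), so the identity `ρ_A(U U*) = (A U)(A U)*`
becomes a statement about upper triangular products (`pair_tmul_tmul`). Polarizing it shows that `ρ`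
is a representation, and that it sends a factor `B` of a point to the factor `A B` of the image.

The polynomials are the pivots of Gaussian elimination from the last position to the first, made
division-free by scaling. One scaled Schur complement doubles the degree. Applied to `A A*` it
strips one column from `A` and multiplies the rest by the pivot (`schurIter_tmul_adj`). Hence `p_i =
a_ii² ∏_{s>i} p_s`, which gives the formula for `a_ii²`, its independence of `A`, and, by downward
induction, the nonvanishing or positivity of `p_i`. The formula for `π²` follows by counting
exponents.

For `χ`, split `A` into a unipotent and a diagonal factor: the first acts with determinant one and
the second by scalars on the matrix coordinates, so `det ρ_A = ∏ a_ii^(2 n_i)` (`det_action`). The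
recursion `r_i = a_ii ∏_{s>i} r_s` produces square roots of the `p_i`. It can be inverted, and every
choice of roots occurs because the columns of `A` may be multiplied by signs (`charValues_eq`). -/

theorem eq_zero_of_not_lt {i j : Fin m} (h : ¬ i < j) (x : 𝒩.N i j) : x = 0 :=
  (𝒩.upper i j h).elim x 0

/-- The isometry condition, polarized in the left factor. -/
theorem form_mul_mul (i j k : Fin m) (x x' : 𝒩.N i j) (y : 𝒩.N j k) :
    𝒩.form i k (𝒩.mul i j k x y) (𝒩.mul i j k x' y) = 𝒩.form i j x x' * 𝒩.form j k y y := by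
  have h := 𝒩.isometric i j k (x + x') y
  simp only [map_add, LinearMap.add_apply, 𝒩.isometric] at h
  rw [𝒩.form_symm i k (𝒩.mul i j k x' y), 𝒩.form_symm i j x' x] at h
  linear_combination h / 2

/-- A linear functional that vanishes on all anisotropic vectors is zero. -/
theorem eq_zero_of_anisotropic {i j : Fin m} (f : 𝒩.N i j →ₗ[K] K)
    (hf : ∀ y, 𝒩.form i j y y ≠ 0 → f y = 0) (y : 𝒩.N i j) : f y = 0 := by
  by_cases hz : ∃ z, 𝒩.form i j z z ≠ 0
  · obtain ⟨z, hz⟩ := hz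
    have h1 := hf (y + z)
    have h2 := hf (y - z)
    have h3 := hf z hz
    by_cases hy : 𝒩.form i j y y = 0
    · by_cases hp : 𝒩.form i j (y + z) (y + z) = 0
      · have hm : 𝒩.form i j (y - z) (y - z) ≠ 0 := by
          intro hm
          apply hz
          simp only [map_add, map_sub, LinearMap.add_apply, LinearMap.sub_apply] at hp hm
          linear_combination hp / 2 + hm / 2 - hy
        simpa [h3] using h2 hm
      · simpa [h3] using h1 hp
    · exact hf y hy
  -- If every vector is isotropic, polarization makes the form zero, and nondegeneracy then makes
  -- the space zero.
  · push Not at hz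
    have : y = 0 := by
      apply (𝒩.form_nondeg i j).1
      intro z
      have h := hz (y + z)
      simp only [map_add, LinearMap.add_apply, hz] at h
      rw [𝒩.form_symm i j z y] at h
      linear_combination h / 2
    simp [this]

/-- The orthogonality condition in the form of a partial associativity law,
`(a x) y♭ = a (x y♭)`. -/
theorem form_mul_mul_of_lt (h p q k : Fin m) (hpq : p < q) (a : 𝒩.N h p) (x : 𝒩.N p k)
    (c : 𝒩.N h q) (y : 𝒩.N q k) :
    𝒩.form h k (𝒩.mul h p k a x) (𝒩.mul h q k c y)
      = 𝒩.form h q (𝒩.mul h p q a (𝒩.mulFlat p q k x y)) c := by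
  let F : 𝒩.N q k →ₗ[K] 𝒩.N p q :=
    { toFun := 𝒩.mulFlat p q k x
      map_add' := mulFlat_add_right p q k x
      map_smul' := fun r y => mulFlat_smul_right p q k r x y }
  -- Both sides are linear in `y`, so `y` may be taken anisotropic.
  have key := eq_zero_of_anisotropic
    ((𝒩.form h k (𝒩.mul h p k a x)) ∘ₗ (𝒩.mul h q k c)
      - (𝒩.form h q).flip c ∘ₗ 𝒩.mul h p q a ∘ₗ F) ?_ y
  · simpa [sub_eq_zero, F] using key
  · intro y hy
    simp only [LinearMap.sub_apply, LinearMap.comp_apply]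
    change _ - 𝒩.form h q (𝒩.mul h p q a (𝒩.mulFlat p q k x y)) c = 0
    set r := 𝒩.form q k y y
    set e := 𝒩.mulFlat p q k x y with he
    -- With `e = x y♭`, isometry makes `r⁻¹ e y` the orthogonal projection of `x` to `N_pq y`. The
    -- axiom removes the complementary part of `x`, and the projected part gives `⟨a e, c⟩` by
    -- associativity and isometry.
    have h0 := 𝒩.orthogonal p q k hpq (x - r⁻¹ • 𝒩.mul p q k e y) y ?_ h a c
    · simp only [map_sub, map_smul, LinearMap.sub_apply, LinearMap.smul_apply, smul_eq_mul,
        ← 𝒩.assoc, form_mul_mul] at h0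
      change _ - r⁻¹ * (_ * r) = 0 at h0
      rw [← h0]
      field_simp
    · intro z
      simp only [map_sub, map_smul, LinearMap.sub_apply, LinearMap.smul_apply, smul_eq_mul,
        form_mul_mul]
      change _ - r⁻¹ * (_ * r) = 0
      rw [he, form_mulFlat]
      field_simp
      ring

theorem form_mulFlat_right (i j k : Fin m) (x : 𝒩.N i k) (y : 𝒩.N j k) (z : 𝒩.N i j) :
    𝒩.form i j z (𝒩.mulFlat i j k x y) = 𝒩.form i k x (𝒩.mul i j k z y) := by
  rw [𝒩.form_symm, form_mulFlat]

/-- The bilinear form `⟨X, Y⟩` on upper triangular parts. -/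
def pair (X Y : 𝒩.TAlg) : K :=
  ∑ i, X.d i * Y.d i + ∑ i, ∑ j, 𝒩.form i j (X.u i j) (Y.u i j)

theorem pair_add_left (X X' Y : 𝒩.TAlg) : pair (X + X') Y = pair X Y + pair X' Y := by
  simp [pair, Finset.sum_add_distrib, add_mul]; ring

theorem pair_single_u (i j : Fin m) (x : 𝒩.N i j) (X : 𝒩.TAlg) :
    pair X (0, Pi.single i (Pi.single j x), 0) = 𝒩.form i j (X.u i j) x := by
  simp only [pair, TAlg.d_mk, TAlg.u_mk, Pi.zero_apply, mul_zero, Finset.sum_const_zero, zero_add]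
  rw [Finset.sum_eq_single i, Finset.sum_eq_single j]
  · simp
  · intro k _ hk
    simp [Pi.single_eq_of_ne hk]
  · simp
  · intro k _ hk
    simp [Pi.single_eq_of_ne hk]
  · simp

theorem pair_single_d (i : Fin m) (X : 𝒩.TAlg) :
    pair X (Pi.single i 1, 0, 0) = X.d i := by
  simp only [pair, TAlg.d_mk, TAlg.u_mk, Pi.zero_apply, map_zero, Finset.sum_const_zero, add_zero]
  simp [Pi.single_apply]

theorem d_u_eq_of_pair {X Y : 𝒩.TAlg} (h : ∀ W ∈ 𝒩.solv, pair X W = pair Y W) :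
    (∀ i, X.d i = Y.d i) ∧ ∀ i j, X.u i j = Y.u i j := by
  refine ⟨fun i => ?_, fun i j => ?_⟩
  · have := h (Pi.single i 1, 0, 0) (fun _ _ => rfl)
    rwa [pair_single_d, pair_single_d] at this
  · rw [← sub_eq_zero]
    apply (𝒩.form_nondeg i j).1
    intro x
    have := h (0, Pi.single i (Pi.single j x), 0) (fun _ _ => rfl)
    rw [pair_single_u, pair_single_u] at this
    simp [this]

theorem herm_ext {X Y : 𝒩.TAlg} (hX : X ∈ 𝒩.herm) (hY : Y ∈ 𝒩.herm)
    (hd : ∀ i, X.d i = Y.d i) (hu : ∀ i j, X.u i j = Y.u i j) : X = Y := by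
  refine TAlg.ext hd hu fun i j => ?_
  have hX : 𝒩.adj X = X := hX
  have hY : 𝒩.adj Y = Y := hY
  rw [← hX, ← hY, l_adj, l_adj, hu]

theorem flatMul_zero_left (i j k : Fin m) (y : 𝒩.N i k) : 𝒩.flatMul i j k 0 y = 0 := by
  simpa using flatMul_smul_left i j k (0 : K) (0 : 𝒩.N i j) y

theorem mulFlat_zero_right (i j k : Fin m) (x : 𝒩.N i k) : 𝒩.mulFlat i j k x 0 = 0 := by
  simpa using mulFlat_smul_right i j k (0 : K) x (0 : 𝒩.N j k)

theorem mulFlat_zero_left (i j k : Fin m) (y : 𝒩.N j k) : 𝒩.mulFlat i j k 0 y = 0 := by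
  simpa using mulFlat_smul_left i j k (0 : K) (0 : 𝒩.N i k) y

theorem flatMul_zero_right (i j k : Fin m) (x : 𝒩.N i j) : 𝒩.flatMul i j k x 0 = 0 := by
  simpa using flatMul_smul_right i j k (0 : K) x (0 : 𝒩.N i k)

/-! ### Products of upper triangular matrices and their pairing. -/

theorem d_tmul (A B : 𝒩.TAlg) (hA : A ∈ 𝒩.solv) (hB : B ∈ 𝒩.solv) (i : Fin m) :
    (𝒩.tmul A B).d i = A.d i * B.d i := by
  change mulD A B i = _
  simp [mulD, hA _ _, hB _ _]

theorem u_tmul (A B : 𝒩.TAlg) (hA : A ∈ 𝒩.solv) (hB : B ∈ 𝒩.solv) (i j : Fin m) :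
    (𝒩.tmul A B).u i j
      = A.d i • B.u i j + B.d j • A.u i j + ∑ k, 𝒩.mul i k j (A.u i k) (B.u k j) := by
  change mulU A B i j = _
  simp [mulU, hA _ _, hB _ _, flatMul_zero_left, mulFlat_zero_right]

theorem tmul_mem_solv {A B : 𝒩.TAlg} (hA : A ∈ 𝒩.solv) (hB : B ∈ 𝒩.solv) :
    𝒩.tmul A B ∈ 𝒩.solv := by
  intro i j
  change mulU (𝒩.adj B) (𝒩.adj A) i j = 0
  simp [mulU, hA _ _, hB _ _, flatMul_zero_right, mulFlat_zero_left]

theorem d_tmul_adj (A B : 𝒩.TAlg) (hA : A ∈ 𝒩.solv) (hB : B ∈ 𝒩.solv) (i : Fin m) :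
    (𝒩.tmul A (𝒩.adj B)).d i = A.d i * B.d i + ∑ k, 𝒩.form i k (A.u i k) (B.u i k) := by
  change mulD A (𝒩.adj B) i = _
  simp [mulD, hA _ _, hB _ _]

theorem u_tmul_adj (A B : 𝒩.TAlg) (hA : A ∈ 𝒩.solv) (hB : B ∈ 𝒩.solv) (i j : Fin m) :
    (𝒩.tmul A (𝒩.adj B)).u i j
      = B.d j • A.u i j + ∑ k, 𝒩.mulFlat i j k (A.u i k) (B.u j k) := by
  change mulU A (𝒩.adj B) i j = _
  simp [mulU, hA _ _, hB _ _, flatMul_zero_left]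

/-- With no entries below the diagonal no product with a covector occurs, so only the associativity
axiom of the Nil-algebra and scalars are involved. -/
theorem tmul_assoc_of_solv {A B C : 𝒩.TAlg} (hA : A ∈ 𝒩.solv) (hB : B ∈ 𝒩.solv)
    (hC : C ∈ 𝒩.solv) : 𝒩.tmul (𝒩.tmul A B) C = 𝒩.tmul A (𝒩.tmul B C) := by
  have hAB := tmul_mem_solv hA hB
  have hBC := tmul_mem_solv hB hC
  refine TAlg.ext (fun i => ?_) (fun i j => ?_) (fun i j => ?_)
  · rw [d_tmul _ _ hAB hC, d_tmul _ _ hA hBC, d_tmul _ _ hA hB, d_tmul _ _ hB hC, mul_assoc]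
  · rw [u_tmul _ _ hAB hC, u_tmul _ _ hA hBC, d_tmul _ _ hA hB, d_tmul _ _ hB hC]
    simp only [u_tmul _ _ hA hB, u_tmul _ _ hB hC, map_add, map_smul, map_sum, LinearMap.add_apply,
      LinearMap.smul_apply, LinearMap.sum_apply, Finset.sum_add_distrib, smul_add, Finset.smul_sum,
      ← 𝒩.assoc, smul_smul]
    rw [Finset.sum_comm (f := fun k l => 𝒩.mul i k j (𝒩.mul i l k (A.u i l) (B.u l k)) (C.u k j))]
    rw [mul_comm (C.d j) (A.d i), mul_comm (C.d j) (B.d j)]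
    abel
  · rw [tmul_mem_solv hAB hC, tmul_mem_solv hA hBC]

/-- The defining property of `mulFlat`, summed over all entries. It trades a product with an adjoint
for a product of upper triangular matrices, where associativity is available. -/
theorem pair_tmul_adj (A B W : 𝒩.TAlg) (hA : A ∈ 𝒩.solv) (hB : B ∈ 𝒩.solv) (hW : W ∈ 𝒩.solv) :
    pair (𝒩.tmul A (𝒩.adj B)) W = pair A (𝒩.tmul W B) := by
  simp only [pair, d_tmul_adj _ _ hA hB, u_tmul_adj _ _ hA hB, d_tmul _ _ hW hB, u_tmul _ _ hW hB,
    map_add, map_sum, map_smul, LinearMap.add_apply, LinearMap.sum_apply, LinearMap.smul_apply,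
    form_mulFlat, smul_eq_mul, add_mul, Finset.sum_add_distrib, Finset.sum_mul]
  have h1 : ∀ i, ∑ j, ∑ k, 𝒩.form i k (A.u i k) (𝒩.mul i j k (W.u i j) (B.u j k))
      = ∑ k, ∑ j, 𝒩.form i k (A.u i k) (𝒩.mul i j k (W.u i j) (B.u j k)) :=
    fun i => Finset.sum_comm
  simp only [h1, mul_comm (W.d _)]
  simp only [mul_assoc]
  ring

/-- The identity behind the multiplicativity of the action: `⟨AU, VU⟩ = ⟨AE, V⟩ + ⟨A, VE⟩`
if `E` is the upper half of `U · U*`. -/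
theorem pair_tmul_tmul (A V U : 𝒩.TAlg) (hA : A ∈ 𝒩.solv) (hV : V ∈ 𝒩.solv) (hU : U ∈ 𝒩.solv) :
    pair (𝒩.tmul A U) (𝒩.tmul V U)
      = pair (𝒩.tmul A (𝒩.upperHalf (𝒩.tmul U (𝒩.adj U)))) V
        + pair A (𝒩.tmul V (𝒩.upperHalf (𝒩.tmul U (𝒩.adj U)))) := by
  set E := 𝒩.upperHalf (𝒩.tmul U (𝒩.adj U))
  have hE : E ∈ 𝒩.solv := fun _ _ => rfl
  have hEd : ∀ i, E.d i = (2 : K)⁻¹ * (U.d i * U.d i + ∑ k, 𝒩.form i k (U.u i k) (U.u i k)) :=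
    fun i => by rw [← d_tmul_adj _ _ hU hU]; rfl
  have hEu : ∀ i j, E.u i j = U.d j • U.u i j + ∑ k, 𝒩.mulFlat i j k (U.u i k) (U.u j k) :=
    fun i j => by rw [← u_tmul_adj _ _ hU hU]; rfl
  -- At most one summand on the right survives: isometry gives the case `p = q`, partial
  -- associativity the cases `p < q` and `q < p`, and the other `mulFlat` terms lie in zero spaces.
  -- The `p = q` terms are shared equally between `A E` and `V E`, through the factor one half in
  -- the diagonal of `E`.
  have key : ∀ i k p q, 𝒩.form i k (𝒩.mul i p k (A.u i p) (U.u p k)) (𝒩.mul i q k (V.u i q) (U.u q k))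
      = (if p = q then 𝒩.form i q (A.u i q) (V.u i q) * 𝒩.form q k (U.u q k) (U.u q k) else 0)
        + 𝒩.form i q (𝒩.mul i p q (A.u i p) (𝒩.mulFlat p q k (U.u p k) (U.u q k))) (V.u i q)
        + 𝒩.form i p (A.u i p) (𝒩.mul i q p (V.u i q) (𝒩.mulFlat q p k (U.u q k) (U.u p k))) := by
    intro i k p q
    rcases lt_trichotomy p q with h | h | h
    · rw [form_mul_mul_of_lt _ _ _ _ h, if_neg h.ne,
        eq_zero_of_not_lt h.asymm (𝒩.mulFlat q p k _ _)]
      simp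
    · subst h
      rw [form_mul_mul, if_pos rfl, eq_zero_of_not_lt (lt_irrefl p) (𝒩.mulFlat p p k _ _)]
      simp
    · rw [𝒩.form_symm, form_mul_mul_of_lt _ _ _ _ h, if_neg h.ne',
        eq_zero_of_not_lt h.asymm (𝒩.mulFlat p q k _ _), 𝒩.form_symm i p]
      simp
  simp only [pair, ← Finset.sum_add_distrib]
  refine Finset.sum_congr rfl fun i _ => ?_
  simp only [d_tmul _ _ hA hU, d_tmul _ _ hV hU, d_tmul _ _ hA hE, d_tmul _ _ hV hE,
    u_tmul _ _ hA hU, u_tmul _ _ hV hU, u_tmul _ _ hA hE, u_tmul _ _ hV hE, hEd, hEu,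
    map_add, map_sum, map_smul, LinearMap.add_apply, LinearMap.sum_apply, LinearMap.smul_apply,
    form_mulFlat, smul_eq_mul, Finset.sum_add_distrib, key, mul_add, add_mul, form_mulFlat_right,
    Finset.sum_ite_eq', Finset.mem_univ, if_true, Finset.mul_sum, Finset.sum_mul]
  have c1 (f : Fin m → Fin m → Fin m → K) :
      ∑ k, ∑ q, ∑ p, f k q p = ∑ q, ∑ p, ∑ k, f k q p := by
    rw [Finset.sum_comm]
    exact Finset.sum_congr rfl fun q _ => Finset.sum_comm
  have c2 (f : Fin m → Fin m → Fin m → K) :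
      ∑ k, ∑ q, ∑ p, f k q p = ∑ p, ∑ q, ∑ k, f k q p := by
    rw [c1, Finset.sum_comm]
  rw [c1 fun k q p => 𝒩.form i q (𝒩.mul i p q (A.u i p) (𝒩.mulFlat p q k (U.u p k) (U.u q k))) (V.u i q),
    c2 fun k q p => 𝒩.form i p (A.u i p) (𝒩.mul i q p (V.u i q) (𝒩.mulFlat q p k (U.u q k) (U.u p k))),
    Finset.sum_comm (f := fun k q => 𝒩.form i q (A.u i q) (V.u i q) * 𝒩.form q k (U.u q k) (U.u q k)),
    Finset.sum_comm (f := fun k q => A.d i * 𝒩.form i k (U.u i k) (𝒩.mul i q k (V.u i q) (U.u q k)))]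
  have e1 : ∑ k, ∑ q, V.d i * 𝒩.form i k (𝒩.mul i q k (A.u i q) (U.u q k)) (U.u i k)
      = ∑ q, ∑ k, V.d i * 𝒩.form i k (U.u i k) (𝒩.mul i q k (A.u i q) (U.u q k)) := by
    rw [Finset.sum_comm]
    simp only [𝒩.form_symm i _ (𝒩.mul i _ _ _ _)]
  rw [e1]
  ring_nf
  have e2 : ∑ q, ∑ k, 𝒩.form q k (U.u q k) (U.u q k) * 𝒩.form i q (A.u i q) (V.u i q) * (1 / 2)
      = (∑ q, ∑ k, 𝒩.form i q (A.u i q) (V.u i q) * 𝒩.form q k (U.u q k) (U.u q k)) * (1 / 2) := by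
    simp only [Finset.sum_mul]
    exact Finset.sum_congr rfl fun q _ => Finset.sum_congr rfl fun k _ => by ring
  rw [e2]
  simp only [← Finset.sum_mul]
  ring

/-! ### Multiplicativity of the action. -/

theorem upperHalf_mem_solv (X : 𝒩.TAlg) : 𝒩.upperHalf X ∈ 𝒩.solv := fun _ _ => rfl

theorem tmul_adj_self_mem_herm (A : 𝒩.TAlg) : 𝒩.tmul A (𝒩.adj A) ∈ 𝒩.herm :=
  adj_tmul A (𝒩.adj A)

/-- `ρ_A (U · U*) = (A · U) · (A · U)*`. -/
theorem action_tmul_adj_self (A U : 𝒩.TAlg) (hA : A ∈ 𝒩.solv) (hU : U ∈ 𝒩.solv) (X : 𝒩.herm)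
    (hX : (X : 𝒩.TAlg) = 𝒩.tmul U (𝒩.adj U)) :
    (action A X : 𝒩.TAlg) = 𝒩.tmul (𝒩.tmul A U) (𝒩.adj (𝒩.tmul A U)) := by
  have hAU := tmul_mem_solv hA hU
  have hAE := tmul_mem_solv hA (upperHalf_mem_solv (𝒩.tmul U (𝒩.adj U)))
  -- Hermitian matrices are determined by their upper triangular parts, hence by pairing with all
  -- upper triangular `W`. Moving the adjoints to the other side turns the claim into
  -- `pair_tmul_tmul` with `V = W A`.
  obtain ⟨hd, hu⟩ := d_u_eq_of_pair (X := action A X)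
    (Y := 𝒩.tmul (𝒩.tmul A U) (𝒩.adj (𝒩.tmul A U))) fun W hW => by
      have hWA := tmul_mem_solv hW hA
      rw [action_apply, hX, pair_add_left, pair_tmul_adj _ _ _ hAE hA hW,
        pair_tmul_adj _ _ _ hA hAE hW, pair_tmul_adj _ _ _ hAU hAU hW,
        ← tmul_assoc_of_solv hW hA hU, ← tmul_assoc_of_solv hW hA (upperHalf_mem_solv _),
        pair_tmul_tmul A _ U hA hWA hU]
  exact herm_ext (action A X).2 (tmul_adj_self_mem_herm _) hd hu

/-- Polarization of `action_tmul_adj_self`. Unlike the squares `U U*`, these expressions exhaust the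
Hermitian matrices: take `V` to be the identity. -/
theorem action_tmul_adj_add (A U V : 𝒩.TAlg) (hA : A ∈ 𝒩.solv) (hU : U ∈ 𝒩.solv)
    (hV : V ∈ 𝒩.solv) (X : 𝒩.herm)
    (hX : (X : 𝒩.TAlg) = 𝒩.tmul U (𝒩.adj V) + 𝒩.tmul V (𝒩.adj U)) :
    (action A X : 𝒩.TAlg) = 𝒩.tmul (𝒩.tmul A U) (𝒩.adj (𝒩.tmul A V))
      + 𝒩.tmul (𝒩.tmul A V) (𝒩.adj (𝒩.tmul A U)) := by
  let S (U : 𝒩.TAlg) : 𝒩.herm := ⟨_, tmul_adj_self_mem_herm U⟩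
  have hX' : X = S (U + V) - S U - S V := by
    apply Subtype.ext
    simp only [S, hX, AddSubgroupClass.coe_sub, map_add, LinearMap.add_apply]
    abel
  rw [hX', map_sub, map_sub, AddSubgroupClass.coe_sub, AddSubgroupClass.coe_sub,
    action_tmul_adj_self A (U + V) hA (add_mem hU hV) _ rfl, action_tmul_adj_self A U hA hU _ rfl,
    action_tmul_adj_self A V hA hV _ rfl]
  simp only [map_add, LinearMap.add_apply]
  abel

theorem one_mem_solv : 𝒩.one ∈ 𝒩.solv := fun _ _ => rfl

theorem tmul_one (A : 𝒩.TAlg) : 𝒩.tmul A 𝒩.one = A := by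
  refine TAlg.ext (fun i => ?_) (fun i j => ?_) (fun i j => ?_)
  · change mulD A 𝒩.one i = A.d i
    simp [mulD, one]
  · change mulU A 𝒩.one i j = A.u i j
    simp [mulU, one, flatMul_zero_right, mulFlat_zero_right]
  · change mulU (𝒩.adj 𝒩.one) (𝒩.adj A) i j = A.l i j
    simp [mulU, one, flatMul_zero_left, mulFlat_zero_left]

theorem one_tmul (A : 𝒩.TAlg) : 𝒩.tmul 𝒩.one A = A := by
  have h := adj_tmul (𝒩.adj A) 𝒩.one
  rw [tmul_one, adj_adj] at h
  exact h.symm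

theorem adj_one : 𝒩.adj 𝒩.one = 𝒩.one := rfl

theorem action_one : action 𝒩.one = (LinearMap.id : 𝒩.herm →ₗ[K] 𝒩.herm) := by
  ext1 X
  apply Subtype.ext
  rw [action_apply, one_tmul, adj_one, tmul_one, one_tmul, upperHalf_add_adj, LinearMap.id_apply]

theorem coe_herm_eq (X : 𝒩.herm) : (X : 𝒩.TAlg)
    = 𝒩.tmul (𝒩.upperHalf X) (𝒩.adj 𝒩.one) + 𝒩.tmul 𝒩.one (𝒩.adj (𝒩.upperHalf X)) := by
  rw [adj_one, tmul_one, one_tmul, upperHalf_add_adj]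

theorem action_tmul (A B : 𝒩.TAlg) (hA : A ∈ 𝒩.solv) (hB : B ∈ 𝒩.solv) :
    action (𝒩.tmul A B) = action A ∘ₗ (action B : 𝒩.herm →ₗ[K] 𝒩.herm) := by
  ext1 X
  apply Subtype.ext
  have hE := upperHalf_mem_solv (X : 𝒩.TAlg)
  have hAB := tmul_mem_solv hA hB
  have hBE := tmul_mem_solv hB hE
  have hBX := action_tmul_adj_add B _ _ hB hE one_mem_solv X (coe_herm_eq X)
  rw [action_tmul_adj_add _ _ _ hAB hE one_mem_solv X (coe_herm_eq X), LinearMap.comp_apply,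
    action_tmul_adj_add A _ _ hA hBE (tmul_mem_solv hB one_mem_solv) _ hBX,
    tmul_assoc_of_solv hA hB hE, tmul_assoc_of_solv hA hB one_mem_solv]

theorem mul_mem_unitComponent {a b : K} (ha : a ∈ unitComponent K) (hb : b ∈ unitComponent K) :
    a * b ∈ unitComponent K := by
  refine ⟨mul_ne_zero ha.1 hb.1, fun h => ?_⟩
  -- If the imaginary unit is zero, all imaginary parts vanish and the real part is multiplicative.
  have him : ∀ z : K, RCLike.im z = 0 := fun z => by
    rw [← RCLike.mul_im_I_ax z, h, map_zero, mul_zero]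
  simpa [RCLike.mul_re, him] using mul_pos (ha.2 h) (hb.2 h)

theorem one_mem_unitComponent : (1 : K) ∈ unitComponent K := ⟨one_ne_zero, fun _ => by simp⟩

theorem inv_mem_unitComponent {a : K} (ha : a ∈ unitComponent K) : a⁻¹ ∈ unitComponent K := by
  refine ⟨inv_ne_zero ha.1, fun h => ?_⟩
  rw [RCLike.inv_re]
  exact div_pos (ha.2 h) (RCLike.normSq_pos.2 ha.1)

theorem prod_mem_unitComponent {α : Type*} (s : Finset α) (f : α → K)
    (hf : ∀ i ∈ s, f i ∈ unitComponent K) : ∏ i ∈ s, f i ∈ unitComponent K :=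
  Finset.prod_induction f (· ∈ unitComponent K) (fun _ _ => mul_mem_unitComponent)
    one_mem_unitComponent hf

theorem tmul_mem_G {A B : 𝒩.TAlg} (hA : A ∈ 𝒩.G) (hB : B ∈ 𝒩.G) : 𝒩.tmul A B ∈ 𝒩.G :=
  ⟨tmul_mem_solv hA.1 hB.1, fun i => by
    rw [d_tmul _ _ hA.1 hB.1]; exact mul_mem_unitComponent (hA.2 i) (hB.2 i)⟩

theorem one_mem_G : 𝒩.one ∈ 𝒩.G := ⟨one_mem_solv, fun _ => one_mem_unitComponent⟩

theorem isFactor_action {A B : 𝒩.TAlg} {X : 𝒩.herm} (hA : A ∈ 𝒩.G) (hB : 𝒩.IsFactor B X) :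
    𝒩.IsFactor (𝒩.tmul A B) (action A X) :=
  ⟨tmul_mem_G hA hB.1, action_tmul_adj_self A B hA.1 hB.1.1 X hB.2⟩

theorem integratesLieAction_action : 𝒩.IntegratesLieAction action := by
  refine ⟨action_one, fun A hA B hB => ⟨tmul_mem_G hA hB, action_tmul A B hA.1 hB.1⟩,
    fun A _ X φ => ?_⟩
  set E := 𝒩.upperHalf X with hE
  have hX : (X : 𝒩.TAlg) = E + 𝒩.adj E := (𝒩.upperHalf_add_adj X).symm
  -- The action is quadratic in the group element, so this is a polynomial of degree at most two in
  -- `t`, whose linear coefficient is the derivative at zero.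
  have key : ∀ t : K, φ (action (𝒩.one + t • A) X)
      = φ X + t * φ (lieAction A X)
        + t ^ 2 * φ (𝒩.tmul (𝒩.tmul A E) (𝒩.adj A) + 𝒩.tmul A (𝒩.adj (𝒩.tmul A E))) := by
    intro t
    rw [action_apply, lieAction, ← hE, hX]
    simp only [map_add, map_smul, LinearMap.add_apply, LinearMap.smul_apply, one_tmul, tmul_one,
      adj_one, adj_tmul, smul_eq_mul]
    ring
  have hderiv (a b c : K) : HasDerivAt (fun t : K => a + t * b + t ^ 2 * c) b 0 := by
    have h := ((hasDerivAt_id' (0 : K)).mul_const b |>.const_add a).fun_add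
      ((hasDerivAt_pow 2 (0 : K)).mul_const c)
    simpa using h
  simp only [key]
  exact hderiv _ _ _

end Algebra
-- The determinant of the action.
section Determinant

variable {K : Type v} [RCLike K] {m : ℕ} {𝒩 : NilAlgebra.{u, v} K m}

/-- The entries in positions `(p, q)` with `w ≤ p + q` vanish. -/
def VanishesFrom (w : ℕ) (X : 𝒩.TAlg) : Prop :=
  (∀ p : Fin m, w ≤ (p : ℕ) + p → X.d p = 0) ∧ ∀ p q : Fin m, w ≤ (p : ℕ) + q → X.u p q = 0

theorem d_upperHalf (X : 𝒩.TAlg) (i : Fin m) : (𝒩.upperHalf X).d i = (2 : K)⁻¹ * X.d i := rfl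

theorem u_upperHalf (X : 𝒩.TAlg) (i j : Fin m) : (𝒩.upperHalf X).u i j = X.u i j := rfl

/-- A unipotent matrix changes the entry in position `(p, q)` only by terms built from entries with
a larger index sum, so `ρ_N - 1` is strictly triangular for the filtration by `p + q`. -/
theorem vanishesFrom_action_sub {N : 𝒩.TAlg} (hN : N ∈ 𝒩.solv) (hd : ∀ i, N.d i = 1) {w : ℕ}
    {X : 𝒩.herm} (hX : VanishesFrom (w + 1) (X : 𝒩.TAlg)) :
    VanishesFrom w ((action N X - X : 𝒩.herm) : 𝒩.TAlg) := by
  set E := 𝒩.upperHalf (X : 𝒩.TAlg) with hEdef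
  have hE : E ∈ 𝒩.solv := upperHalf_mem_solv _
  have hEd : ∀ p : Fin m, w + 1 ≤ (p : ℕ) + p → E.d p = 0 := fun p hp => by
    rw [hEdef, d_upperHalf, hX.1 p hp, mul_zero]
  have hEu : ∀ p q : Fin m, w + 1 ≤ (p : ℕ) + q → E.u p q = 0 := hX.2
  set B := 𝒩.tmul N E with hBdef
  have hB : B ∈ 𝒩.solv := tmul_mem_solv hN hE
  have hBd : ∀ p, B.d p = E.d p := fun p => by rw [hBdef, d_tmul _ _ hN hE, hd, one_mul]
  -- The bound `w` suffices here: the corrections involve only `E.d q` and `E.u k q` with `k > p`,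
  -- whose index sums exceed `p + q`.
  have hBu : ∀ p q : Fin m, w ≤ (p : ℕ) + q → B.u p q = E.u p q := by
    intro p q h
    by_cases hpq : p < q
    · rw [hBdef, u_tmul _ _ hN hE, hd, one_smul, hEd q (by omega), zero_smul, add_zero,
        Finset.sum_eq_zero, add_zero]
      intro k _
      by_cases hpk : p < k
      · rw [hEu k q (by omega), map_zero]
      · rw [eq_zero_of_not_lt hpk (N.u p k), map_zero, LinearMap.zero_apply]
    · rw [eq_zero_of_not_lt hpq (B.u p q), eq_zero_of_not_lt hpq (E.u p q)]
  have hBu0 : ∀ p q : Fin m, w + 1 ≤ (p : ℕ) + q → B.u p q = 0 := fun p q h => by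
    rw [hBu p q (by omega), hEu p q h]
  have hBd0 : ∀ p : Fin m, w + 1 ≤ (p : ℕ) + p → B.d p = 0 := fun p h => by rw [hBd, hEd p h]
  have hcoe : ((action N X - X : 𝒩.herm) : 𝒩.TAlg)
      = 𝒩.tmul B (𝒩.adj N) + 𝒩.tmul N (𝒩.adj B) + (-1 : K) • (X : 𝒩.TAlg) := by
    rw [AddSubgroupClass.coe_sub, action_apply, neg_one_smul, sub_eq_add_neg]
  have hform : ∀ p k : Fin m, w ≤ (p : ℕ) + p → B.u p k = 0 := by
    intro p k h
    by_cases hpk : p < k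
    · exact hBu0 p k (by omega)
    · exact eq_zero_of_not_lt hpk _
  rw [hcoe]
  refine ⟨fun p h => ?_, fun p q h => ?_⟩
  · rw [TAlg.d_add, TAlg.d_add, TAlg.d_smul, d_tmul_adj _ _ hB hN, d_tmul_adj _ _ hN hB,
      Finset.sum_eq_zero, Finset.sum_eq_zero, hBd, hd, hEdef, d_upperHalf]
    · ring
    · intro k _
      rw [hform p k h, map_zero]
    · intro k _
      rw [hform p k h, map_zero, LinearMap.zero_apply]
  · by_cases hpq : p < q
    · rw [TAlg.u_add, TAlg.u_add, TAlg.u_smul, u_tmul_adj _ _ hB hN, u_tmul_adj _ _ hN hB,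
        Finset.sum_eq_zero, Finset.sum_eq_zero, hBd0 q (by omega), hd, hBu p q h, hEdef,
        u_upperHalf]
      · simp
      · intro k _
        by_cases hqk : q < k
        · rw [hBu0 q k (by omega), mulFlat_zero_right]
        · rw [eq_zero_of_not_lt hqk (B.u q k), mulFlat_zero_right]
      · intro k _
        by_cases hqk : q < k
        · rw [hBu0 p k (by omega), mulFlat_zero_left]
        · rw [eq_zero_of_not_lt hqk (N.u q k), mulFlat_zero_right]
    · exact eq_zero_of_not_lt hpq _

theorem isNilpotent_action_sub_one {N : 𝒩.TAlg} (hN : N ∈ 𝒩.solv) (hd : ∀ i, N.d i = 1) :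
    IsNilpotent ((action N : Module.End K 𝒩.herm) - 1) := by
  refine ⟨2 * m, LinearMap.ext fun X => ?_⟩
  -- Index sums are below `2 * m`, so the condition is empty for `n = 0`. Each application lowers
  -- the threshold by one, and threshold zero means that everything vanishes.
  have h : ∀ n, n ≤ 2 * m → VanishesFrom (2 * m - n)
      (((((action N : Module.End K 𝒩.herm) - 1) ^ n) X : 𝒩.herm) : 𝒩.TAlg) := by
    intro n
    induction n with
    | zero =>
      intro _
      exact ⟨fun p h => by have := p.2; omega, fun p q h => by have := p.2; have := q.2; omega⟩
    | succ n ih =>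
      intro hn
      have hs : 2 * m - n = 2 * m - (n + 1) + 1 := by omega
      have := ih (by omega)
      rw [hs] at this
      rw [pow_succ', Module.End.mul_apply]
      exact vanishesFrom_action_sub hN hd this
  have h0 := h (2 * m) le_rfl
  apply Subtype.ext
  refine herm_ext (Subtype.property _) (Subtype.property _) (fun i => ?_) fun i j => ?_
  · exact h0.1 i (by omega)
  · exact h0.2 i j (by omega)

/-- Evaluate at `1` the characteristic polynomial of the nilpotent map `1 - f`, which is a power of
the variable. -/
theorem det_eq_one_of_isNilpotent_sub_one {V : Type*} [AddCommGroup V] [Module K V]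
    [FiniteDimensional K V] (f : Module.End K V) (hf : IsNilpotent (f - 1)) :
    LinearMap.det f = 1 := by
  have h : IsNilpotent (1 - f) := by
    rw [← neg_sub]
    exact hf.neg
  have h1 := LinearMap.eval_charpoly (1 - f) 1
  rw [h.charpoly_eq_X_pow_finrank, Polynomial.eval_pow, Polynomial.eval_X, one_pow, map_one,
    sub_sub_cancel] at h1
  exact h1.symm

theorem det_action_unipotent {N : 𝒩.TAlg} (hN : N ∈ 𝒩.solv) (hd : ∀ i, N.d i = 1) :
    LinearMap.det (action N : 𝒩.herm →ₗ[K] 𝒩.herm) = 1 :=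
  det_eq_one_of_isNilpotent_sub_one _ (isNilpotent_action_sub_one hN hd)

/-- The matrix coordinates as a linear equivalence. -/
noncomputable def coordsEquiv {ι : Fin m → Fin m → Type w} [∀ i j, Finite (ι i j)]
    (b : ∀ i j, Module.Basis (ι i j) K (𝒩.N i j)) : 𝒩.herm ≃ₗ[K] (CoordIndex ι → K) where
  toFun := coords b
  map_add' X Y := by
    funext s
    rcases s with i | s <;> simp [coords]
  map_smul' c X := by
    funext s
    rcases s with i | s <;> simp [coords]
  invFun f := ⟨(fun i => f (Sum.inl i), fun i j => (b i j).equivFun.symm fun a => f (Sum.inr ⟨i, j, a⟩),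
    fun i j => (b i j).equivFun.symm fun a => f (Sum.inr ⟨i, j, a⟩)), rfl⟩
  left_inv X := by
    apply Subtype.ext
    refine herm_ext rfl X.2 (fun i => rfl) fun i j => ?_
    rw [TAlg.u_mk, LinearEquiv.symm_apply_eq]
    rfl
  right_inv f := by
    funext s
    rcases s with i | ⟨i, j, a⟩
    · rfl
    · change (b i j).equivFun ((b i j).equivFun.symm fun a => f (Sum.inr ⟨i, j, a⟩)) a = _
      rw [LinearEquiv.apply_symm_apply]

theorem action_diagonal_d (D : 𝒩.TAlg) (hD : D ∈ 𝒩.solv) (hu : ∀ i j, D.u i j = 0) (X : 𝒩.herm)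
    (i : Fin m) : (action D X : 𝒩.TAlg).d i = D.d i * D.d i * (X : 𝒩.TAlg).d i := by
  have hE := upperHalf_mem_solv (X : 𝒩.TAlg)
  have hB := tmul_mem_solv hD hE
  rw [action_apply, TAlg.d_add, d_tmul_adj _ _ hB hD, d_tmul_adj _ _ hD hB, d_tmul _ _ hD hE]
  simp [hu, d_upperHalf]
  ring

theorem action_diagonal_u (D : 𝒩.TAlg) (hD : D ∈ 𝒩.solv) (hu : ∀ i j, D.u i j = 0) (X : 𝒩.herm)
    (i j : Fin m) : (action D X : 𝒩.TAlg).u i j = (D.d i * D.d j) • (X : 𝒩.TAlg).u i j := by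
  have hE := upperHalf_mem_solv (X : 𝒩.TAlg)
  have hB := tmul_mem_solv hD hE
  rw [action_apply, TAlg.u_add, u_tmul_adj _ _ hB hD, u_tmul_adj _ _ hD hB, u_tmul _ _ hD hE]
  simp [hu, u_upperHalf, mulFlat_zero_left, mulFlat_zero_right, smul_smul, mul_comm]

theorem det_action_diagonal (D : 𝒩.TAlg) (hD : D ∈ 𝒩.solv) (hu : ∀ i j, D.u i j = 0) :
    LinearMap.det (action D : 𝒩.herm →ₗ[K] 𝒩.herm)
      = (∏ i, D.d i * D.d i)
        * ∏ i, ∏ j, (D.d i * D.d j) ^ Module.finrank K (𝒩.N i j) := by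
  classical
  let e := coordsEquiv fun i j => Module.finBasis K (𝒩.N i j)
  let c : CoordIndex (fun i j => Fin (Module.finrank K (𝒩.N i j))) → K :=
    Sum.elim (fun i => D.d i * D.d i) fun s => D.d s.1 * D.d s.2.1
  have h : (e : _ →ₗ[K] _) ∘ₗ action D ∘ₗ (e.symm : _ →ₗ[K] _) = Matrix.toLin' (Matrix.diagonal c) := by
    refine LinearMap.ext fun f => ?_
    obtain ⟨X, rfl⟩ := e.surjective f
    simp only [LinearMap.comp_apply, LinearEquiv.coe_coe, LinearEquiv.symm_apply_apply]
    funext s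
    rw [Matrix.toLin'_apply, Matrix.mulVec_diagonal]
    rcases s with i | ⟨i, j, a⟩
    · exact action_diagonal_d D hD hu X i
    · change (Module.finBasis K (𝒩.N i j)).repr _ a = _ * (Module.finBasis K (𝒩.N i j)).repr _ a
      rw [action_diagonal_u D hD hu, map_smul]
      rfl
  rw [← LinearMap.det_conj _ e, h, LinearMap.det_toLin', Matrix.det_diagonal, Fintype.prod_sum_type,
    Fintype.prod_sigma]
  simp [c, Fintype.prod_sigma]

/-- In `A = N D` only the diagonal factor `D` contributes. It scales `x_ij` by `a_ii a_jj`.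
Collecting the powers of one `a_ii` gives the dimensions of row and column `i`, plus two from the
entry `x_ii`. -/
theorem det_action {A : 𝒩.TAlg} (hA : A ∈ 𝒩.G) :
    LinearMap.det (action A : 𝒩.herm →ₗ[K] 𝒩.herm) = ∏ i, A.d i ^ 𝒩.twoN i := by
  have hne : ∀ i, A.d i ≠ 0 := fun i => (hA.2 i).1
  let D : 𝒩.TAlg := (A.d, 0, 0)
  let N : 𝒩.TAlg := (fun _ => 1, fun i j => (A.d j)⁻¹ • A.u i j, 0)
  have hD : D ∈ 𝒩.solv := fun _ _ => rfl
  have hN : N ∈ 𝒩.solv := fun _ _ => rfl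
  have hND : A = 𝒩.tmul N D := by
    refine TAlg.ext (fun i => ?_) (fun i j => ?_) (fun i j => ?_)
    · rw [d_tmul _ _ hN hD]
      simp [N, D]
    · rw [u_tmul _ _ hN hD]
      simp [N, D, smul_smul, hne j]
    · rw [hA.1, tmul_mem_solv hN hD]
  rw [hND, action_tmul N D hN hD, LinearMap.det_comp, det_action_unipotent hN (fun _ => rfl), one_mul,
    det_action_diagonal D hD (fun _ _ => rfl), ← hND]
  change (∏ i, A.d i * A.d i) * ∏ i, ∏ j, (A.d i * A.d j) ^ Module.finrank K (𝒩.N i j) = _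
  have hprod : ∏ i, ∏ j, (A.d i * A.d j) ^ Module.finrank K (𝒩.N i j)
      = ∏ i, ∏ j, A.d i ^ (Module.finrank K (𝒩.N i j) + Module.finrank K (𝒩.N j i)) := by
    simp only [mul_pow, pow_add, Finset.prod_mul_distrib]
    rw [Finset.prod_comm (f := fun i j => A.d j ^ Module.finrank K (𝒩.N i j))]
  rw [hprod, ← Finset.prod_mul_distrib]
  refine Finset.prod_congr rfl fun i _ => ?_
  have h0 : Module.finrank K (𝒩.N i i) = 0 := by
    have := 𝒩.upper i i (lt_irrefl i)
    exact Module.finrank_zero_of_subsingleton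
  rw [Finset.prod_pow_eq_pow_sum, twoN, ← Finset.add_sum_erase _ _ (Finset.mem_univ i), h0,
    zpow_add₀ (hne i), zpow_two, add_zero, zero_add, ← zpow_natCast]
  push_cast
  rfl

end Determinant
-- The pivots of scaled elimination and the diagonal group coordinates.
section Polynomials

variable {K : Type v} [RCLike K] {m : ℕ} {𝒩 : NilAlgebra.{u, v} K m}
  {ι : Fin m → Fin m → Type w} (b : ∀ i j, Module.Basis (ι i j) K (𝒩.N i j))

/-- The function `F` is a homogeneous polynomial of degree `d` in the matrix coordinates. -/
def IsPolyMap (d : ℕ) (F : 𝒩.herm → K) : Prop :=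
  ∃ P : MvPolynomial (CoordIndex ι) K, P.IsHomogeneous d ∧
    ∀ X, MvPolynomial.eval (coords b X) P = F X

variable {b}

theorem IsPolyMap.add {d : ℕ} {F G : 𝒩.herm → K} (hF : IsPolyMap b d F) (hG : IsPolyMap b d G) :
    IsPolyMap b d fun X => F X + G X := by
  obtain ⟨P, hP, hPF⟩ := hF
  obtain ⟨Q, hQ, hQG⟩ := hG
  exact ⟨P + Q, hP.add hQ, fun X => by rw [map_add, hPF, hQG]⟩

theorem IsPolyMap.mul {d e : ℕ} {F G : 𝒩.herm → K} (hF : IsPolyMap b d F) (hG : IsPolyMap b e G) :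
    IsPolyMap b (d + e) fun X => F X * G X := by
  obtain ⟨P, hP, hPF⟩ := hF
  obtain ⟨Q, hQ, hQG⟩ := hG
  exact ⟨P * Q, hP.mul hQ, fun X => by rw [map_mul, hPF, hQG]⟩

theorem IsPolyMap.const_mul {d : ℕ} {F : 𝒩.herm → K} (hF : IsPolyMap b d F) (c : K) :
    IsPolyMap b d fun X => c * F X := by
  obtain ⟨P, hP, hPF⟩ := hF
  refine ⟨MvPolynomial.C c * P, ?_, fun X => by rw [map_mul, MvPolynomial.eval_C, hPF]⟩
  simpa using (MvPolynomial.isHomogeneous_C _ c).mul hP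

theorem IsPolyMap.sub {d : ℕ} {F G : 𝒩.herm → K} (hF : IsPolyMap b d F) (hG : IsPolyMap b d G) :
    IsPolyMap b d fun X => F X - G X := by
  simpa [sub_eq_add_neg] using hF.add (hG.const_mul (-1))

theorem IsPolyMap.sum {α : Type*} (s : Finset α) {d : ℕ} {F : α → 𝒩.herm → K}
    (hF : ∀ a ∈ s, IsPolyMap b d (F a)) : IsPolyMap b d fun X => ∑ a ∈ s, F a X := by
  classical
  induction s using Finset.induction_on with
  | empty => exact ⟨0, MvPolynomial.isHomogeneous_zero _ _ _, fun X => by simp⟩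
  | insert a s ha ih =>
    simp only [Finset.sum_insert ha]
    exact (hF a (Finset.mem_insert_self a s)).add
      (ih fun c hc => hF c (Finset.mem_insert_of_mem hc))

theorem isPolyMap_coord (s : CoordIndex ι) : IsPolyMap b 1 fun X => coords b X s :=
  ⟨MvPolynomial.X s, MvPolynomial.isHomogeneous_X _ _, fun _ => MvPolynomial.eval_X s⟩

variable (b) in
/-- The vector-valued function `F` is a homogeneous polynomial map of degree `d` in the matrix
coordinates. -/
def IsPolyVec (d : ℕ) {i j : Fin m} (F : 𝒩.herm → 𝒩.N i j) : Prop :=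
  ∀ φ : 𝒩.N i j →ₗ[K] K, IsPolyMap b d fun X => φ (F X)

theorem IsPolyMap.bilin {d e : ℕ} {i j k l : Fin m} {F : 𝒩.herm → 𝒩.N i j} {G : 𝒩.herm → 𝒩.N k l}
    (hF : IsPolyVec b d F) (hG : IsPolyVec b e G) (β : 𝒩.N i j →ₗ[K] 𝒩.N k l →ₗ[K] K) :
    IsPolyMap b (d + e) fun X => β (F X) (G X) := by
  let B := Module.finBasis K (𝒩.N i j)
  let C := Module.finBasis K (𝒩.N k l)
  have h : ∀ X, β (F X) (G X)
      = ∑ a, ∑ c, β (B a) (C c) * (B.coord a (F X) * C.coord c (G X)) := by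
    intro X
    conv_lhs => rw [← B.sum_repr (F X), ← C.sum_repr (G X)]
    simp only [map_sum, map_smul, LinearMap.sum_apply, LinearMap.smul_apply, smul_eq_mul,
      Module.Basis.coord_apply, Finset.mul_sum]
    rw [Finset.sum_comm]
    refine Finset.sum_congr rfl fun a _ => Finset.sum_congr rfl fun c _ => ?_
    ring
  simp only [h]
  exact IsPolyMap.sum _ fun a _ => IsPolyMap.sum _ fun c _ =>
    ((hF (B.coord a)).mul (hG (C.coord c))).const_mul _

/-- The scaled Schur complement of `X` with respect to its diagonal entry in position `(k, k)`. -/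
noncomputable def schur (k : Fin m) (X : 𝒩.TAlg) : 𝒩.TAlg :=
  (fun i => X.d k * X.d i - 𝒩.form i k (X.u i k) (X.u i k),
    fun i j => X.d k • X.u i j - 𝒩.mulFlat i j k (X.u i k) (X.u j k), 0)

/-- The result of `t` successive Schur complements, at the positions `m - 1, m - 2, …`. -/
noncomputable def schurIter (X : 𝒩.TAlg) : ℕ → 𝒩.TAlg
  | 0 => X
  | t + 1 => if h : t < m then schur (Fin.rev ⟨t, h⟩) (schurIter X t) else schurIter X t

/-- After `m - 1 - k` steps exactly the positions beyond `k` have been eliminated, and `k` is next.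
-/
theorem schurIter_succ (X : 𝒩.TAlg) (k : Fin m) :
    schurIter X (m - 1 - k + 1) = schur k (schurIter X (m - 1 - k)) := by
  have hk := k.2
  have h : m - 1 - (k : ℕ) < m := by omega
  have hrev : Fin.rev ⟨m - 1 - (k : ℕ), h⟩ = k := by
    apply Fin.ext
    rw [Fin.val_rev]
    dsimp only
    omega
  rw [schurIter, dif_pos h, hrev]

/-- The value at `X` of the `i`-th polynomial. -/
noncomputable def pivot (X : 𝒩.TAlg) (i : Fin m) : K := (schurIter X (m - 1 - i)).d i

/-- A scaled Schur complement involves no division and is homogeneous quadratic in the entries, so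
each step doubles the degree. -/
theorem isPolyMap_schurIter (t : ℕ) (ht : t ≤ m) :
    (∀ i, IsPolyMap b (2 ^ t) fun X : 𝒩.herm => (schurIter (X : 𝒩.TAlg) t).d i) ∧
      ∀ i j, IsPolyVec b (2 ^ t) fun X : 𝒩.herm => (schurIter (X : 𝒩.TAlg) t).u i j := by
  induction t with
  | zero =>
    refine ⟨fun i => isPolyMap_coord (Sum.inl i), fun i j φ => ?_⟩
    have := Module.Finite.finite_basis (b i j)
    have := Fintype.ofFinite (ι i j)
    have h : ∀ X : 𝒩.herm, φ ((schurIter (X : 𝒩.TAlg) 0).u i j)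
        = ∑ a, φ (b i j a) * coords b X (Sum.inr ⟨i, j, a⟩) := by
      intro X
      change φ ((X : 𝒩.TAlg).u i j) = _
      conv_lhs => rw [← (b i j).sum_repr ((X : 𝒩.TAlg).u i j)]
      simp only [map_sum, map_smul, smul_eq_mul]
      exact Finset.sum_congr rfl fun a _ => mul_comm _ _
    simp only [h]
    exact IsPolyMap.sum _ fun a _ => (isPolyMap_coord _).const_mul _
  | succ t ih =>
    obtain ⟨hd, hu⟩ := ih (by omega)
    have h : t < m := ht
    simp only [schurIter, dif_pos h, pow_succ, mul_two]
    set k := Fin.rev ⟨t, h⟩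
    refine ⟨fun i => ((hd k).mul (hd i)).sub (IsPolyMap.bilin (hu i k) (hu i k) (𝒩.form i k)),
      fun i j φ => ?_⟩
    simp only [schur, TAlg.u_mk, map_sub, map_smul, smul_eq_mul]
    let β : 𝒩.N i k →ₗ[K] 𝒩.N j k →ₗ[K] 𝒩.N i j := LinearMap.mk₂ K (𝒩.mulFlat i j k)
      (mulFlat_add_left i j k) (mulFlat_smul_left i j k) (mulFlat_add_right i j k)
      (fun c x y => mulFlat_smul_right i j k c x y)
    exact ((hd k).mul (hu i j φ)).sub
      (IsPolyMap.bilin (hu i k) (hu j k) (LinearMap.compr₂ β φ))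

theorem isPolyMap_pivot (i : Fin m) :
    IsPolyMap b (2 ^ (m - 1 - (i : ℕ))) fun X : 𝒩.herm => pivot (X : 𝒩.TAlg) i :=
  (isPolyMap_schurIter _ (by omega)).1 i

/-- The upper triangular matrix `A` with the off-diagonal part of all columns from the `n`-th on
removed. -/
def truncCols (n : ℕ) (A : 𝒩.TAlg) : 𝒩.TAlg :=
  (A.d, fun i k => if (k : ℕ) < n then A.u i k else 0, 0)

theorem truncCols_mem_solv (n : ℕ) (A : 𝒩.TAlg) : truncCols n A ∈ 𝒩.solv := fun _ _ => rfl

theorem filter_le_val_eq_insert (k : Fin m) :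
    Finset.univ.filter (fun s : Fin m => (k : ℕ) ≤ s)
      = insert k (Finset.univ.filter fun s : Fin m => (k : ℕ) + 1 ≤ s) := by
  ext s
  simp only [Finset.mem_filter, Finset.mem_univ, true_and, Finset.mem_insert, Fin.ext_iff]
  omega

theorem sum_truncCols_succ {M : Type*} [AddCommMonoid M] (k : Fin m) (f : Fin m → M) :
    (∑ l : Fin m, if (l : ℕ) < k + 1 then f l else 0)
      = (∑ l : Fin m, if (l : ℕ) < k then f l else 0) + f k := by
  have h : ∀ l : Fin m, (if (l : ℕ) < k + 1 then f l else 0)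
      = (if (l : ℕ) < k then f l else 0) + if l = k then f l else 0 := by
    intro l
    rcases lt_trichotomy l k with h | h | h
    · rw [if_pos (by omega), if_pos (Fin.lt_def.1 h), if_neg h.ne, add_zero]
    · subst h
      simp
    · rw [if_neg (by omega), if_neg (by omega), if_neg h.ne', add_zero]
  rw [Finset.sum_congr rfl fun l _ => h l, Finset.sum_add_distrib, Finset.sum_ite_eq',
    if_pos (Finset.mem_univ k)]

theorem d_truncCols_tmul_adj (n : ℕ) (A : 𝒩.TAlg) (i : Fin m) :
    (𝒩.tmul (truncCols n A) (𝒩.adj (truncCols n A))).d i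
      = A.d i * A.d i + ∑ l : Fin m, if (l : ℕ) < n then 𝒩.form i l (A.u i l) (A.u i l) else 0 := by
  rw [d_tmul_adj _ _ (truncCols_mem_solv n A) (truncCols_mem_solv n A)]
  congr 1
  refine Finset.sum_congr rfl fun l _ => ?_
  simp only [truncCols, TAlg.u_mk]
  split_ifs <;> simp

theorem u_truncCols_tmul_adj (n : ℕ) (A : 𝒩.TAlg) (i j : Fin m) (hj : (j : ℕ) < n) :
    (𝒩.tmul (truncCols n A) (𝒩.adj (truncCols n A))).u i j
      = A.d j • A.u i j
        + ∑ l : Fin m, if (l : ℕ) < n then 𝒩.mulFlat i j l (A.u i l) (A.u j l) else 0 := by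
  rw [u_tmul_adj _ _ (truncCols_mem_solv n A) (truncCols_mem_solv n A)]
  congr 1
  · simp [truncCols, hj]
  refine Finset.sum_congr rfl fun l _ => ?_
  simp only [truncCols, TAlg.u_mk]
  split_ifs <;> simp [mulFlat_zero_right]

/-- The off-diagonal entries in row `k` lie in columns beyond `k`, all of which have been removed.
-/
theorem d_truncCols_pivot (A : 𝒩.TAlg) (k : Fin m) :
    (𝒩.tmul (truncCols (k + 1) A) (𝒩.adj (truncCols (k + 1) A))).d k = A.d k * A.d k := by
  rw [d_truncCols_tmul_adj, Finset.sum_eq_zero, add_zero]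
  intro l _
  split_ifs with h
  · rw [eq_zero_of_not_lt (by omega) (A.u k l), map_zero]
  · rfl

theorem u_truncCols_pivot (A : 𝒩.TAlg) (i k : Fin m) :
    (𝒩.tmul (truncCols (k + 1) A) (𝒩.adj (truncCols (k + 1) A))).u i k = A.d k • A.u i k := by
  rw [u_truncCols_tmul_adj _ _ _ _ (Nat.lt_succ_self _), Finset.sum_eq_zero, add_zero]
  intro l _
  split_ifs with h
  · rw [eq_zero_of_not_lt (by omega) (A.u k l), mulFlat_zero_right]
  · rfl

/-- Suppose the current matrix is `c` times `B B*`, with `B` obtained from `A` by truncating after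
column `k`. Its pivot is `p_k = c a_kk²` and its column `k` has entries `c a_kk a_ik`. The scaled
complement is therefore `p_k c ((B B*)_ij - a_ik a_jk♭)`, and the subtracted term is exactly the
contribution of column `k`. Thus `p_k` joins the prefactor and column `k` is removed. -/
theorem schurIter_tmul_adj (A X : 𝒩.TAlg) (hA : A ∈ 𝒩.solv) (hX : X = 𝒩.tmul A (𝒩.adj A)) (t : ℕ)
    (ht : t ≤ m) :
    (∀ i : Fin m, (i : ℕ) < m - t → (schurIter X t).d i
      = (∏ s ∈ Finset.univ.filter (fun s : Fin m => m - t ≤ (s : ℕ)), pivot X s)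
        * (𝒩.tmul (truncCols (m - t) A) (𝒩.adj (truncCols (m - t) A))).d i) ∧
    ∀ i j : Fin m, (i : ℕ) < m - t → (j : ℕ) < m - t → (schurIter X t).u i j
      = (∏ s ∈ Finset.univ.filter (fun s : Fin m => m - t ≤ (s : ℕ)), pivot X s)
        • (𝒩.tmul (truncCols (m - t) A) (𝒩.adj (truncCols (m - t) A))).u i j := by
  induction t with
  | zero =>
    have h1 : ∏ s ∈ Finset.univ.filter (fun s : Fin m => m - 0 ≤ (s : ℕ)), pivot X s = 1 := by
      apply Finset.prod_eq_one
      intro s hs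
      have := (Finset.mem_filter.1 hs).2
      omega
    have h2 : truncCols (m - 0) A = A := by
      refine TAlg.ext (fun i => rfl) (fun i j => ?_) (fun i j => (hA i j).symm)
      simp [truncCols]
    rw [h1, h2]
    exact ⟨fun i _ => by rw [one_mul, ← hX]; rfl, fun i j _ _ => by rw [one_smul, ← hX]; rfl⟩
  | succ t ih =>
    obtain ⟨hd, hu⟩ := ih (by omega)
    let k : Fin m := ⟨m - (t + 1), by omega⟩
    have hk : m - t = (k : ℕ) + 1 := by simp only [k]; omega
    have hk' : m - (t + 1) = (k : ℕ) := rfl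
    have hkt : t = m - 1 - (k : ℕ) := by simp only [k]; omega
    rw [hk] at hd hu
    rw [hk', filter_le_val_eq_insert, Finset.prod_insert (by simp)]
    have hpk : pivot X k = (∏ s ∈ Finset.univ.filter (fun s : Fin m => (k : ℕ) + 1 ≤ (s : ℕ)), pivot X s) * (A.d k * A.d k) := by
      rw [← d_truncCols_pivot, ← hd k (by omega), pivot, ← hkt]
    have hstep : schurIter X (t + 1) = schur k (schurIter X t) := by
      rw [hkt, schurIter_succ]
    set c := ∏ s ∈ Finset.univ.filter (fun s : Fin m => (k : ℕ) + 1 ≤ (s : ℕ)), pivot X s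
    have hdk : (schurIter X t).d k = c * (A.d k * A.d k) := by
      rw [hd k (by omega), d_truncCols_pivot]
    have huk : ∀ i : Fin m, (i : ℕ) < k → (schurIter X t).u i k = (c * A.d k) • A.u i k := by
      intro i hi
      rw [hu i k (by omega) (by omega), u_truncCols_pivot, smul_smul]
    rw [hstep, hpk]
    refine ⟨fun i hi => ?_, fun i j hi hj => ?_⟩
    · rw [schur, TAlg.d_mk, hdk, hd i (by omega), huk i hi, d_truncCols_tmul_adj,
        d_truncCols_tmul_adj, sum_truncCols_succ]
      simp only [map_smul, LinearMap.smul_apply, smul_eq_mul]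
      ring
    · rw [schur, TAlg.u_mk, hdk, hu i j (by omega) (by omega), huk i hi, huk j hj,
        u_truncCols_tmul_adj _ _ _ _ (by omega), u_truncCols_tmul_adj _ _ _ _ hj,
        sum_truncCols_succ, mulFlat_smul_left, mulFlat_smul_right]
      module

/-- The diagonal entry of `schurIter_tmul_adj` in position `i`, read just before that position is
eliminated. -/
theorem pivot_eq {A : 𝒩.TAlg} {X : 𝒩.herm} (h : 𝒩.IsFactor A X) (i : Fin m) :
    pivot (X : 𝒩.TAlg) i = (∏ s ∈ Finset.Ioi i, pivot (X : 𝒩.TAlg) s) * A.d i ^ 2 := by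
  have hi := i.2
  have h1 := (schurIter_tmul_adj A X h.1.1 h.2 (m - 1 - i) (by omega)).1 i (by omega)
  have h2 : m - (m - 1 - (i : ℕ)) = i + 1 := by omega
  have h3 : Finset.univ.filter (fun s : Fin m => (i : ℕ) + 1 ≤ s) = Finset.Ioi i := by
    ext s
    simp only [Finset.mem_filter, Finset.mem_univ, true_and, Finset.mem_Ioi, Fin.lt_def]
    omega
  rw [h2, h3, d_truncCols_pivot, ← sq] at h1
  exact h1

theorem strong_induction_Ioi {P : Fin m → Prop} (h : ∀ i, (∀ s ∈ Finset.Ioi i, P s) → P i)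
    (i : Fin m) : P i := by
  induction i using WellFoundedGT.induction with
  | ind i ih => exact h i fun s hs => ih s (Finset.mem_Ioi.1 hs)

/-- Downward induction along `pivot_eq`. It covers nonvanishing over both fields and positivity over
the reals. -/
theorem pivot_mem_unitComponent {A : 𝒩.TAlg} {X : 𝒩.herm} (h : 𝒩.IsFactor A X) (i : Fin m) :
    pivot (X : 𝒩.TAlg) i ∈ unitComponent K := by
  induction i using strong_induction_Ioi with
  | h i ih =>
    rw [pivot_eq h, sq]
    exact mul_mem_unitComponent (prod_mem_unitComponent _ _ ih)
      (mul_mem_unitComponent (h.1.2 i) (h.1.2 i))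

theorem sq_d_eq {A : 𝒩.TAlg} {X : 𝒩.herm} (h : 𝒩.IsFactor A X) (i : Fin m) :
    A.d i ^ 2 = pivot (X : 𝒩.TAlg) i / ∏ s ∈ Finset.Ioi i, pivot (X : 𝒩.TAlg) s := by
  have hne : ∏ s ∈ Finset.Ioi i, pivot (X : 𝒩.TAlg) s ≠ 0 :=
    Finset.prod_ne_zero_iff.2 fun s _ => (pivot_mem_unitComponent h s).1
  rw [pivot_eq h i, mul_div_cancel_left₀ _ hne]

theorem diagSq_eq_pivot {X : 𝒩.herm} (hX : X ∈ 𝒩.cone) (i : Fin m) :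
    diagSq X i = pivot (X : 𝒩.TAlg) i / ∏ s ∈ Finset.Ioi i, pivot (X : 𝒩.TAlg) s := by
  have hX' : ∃ A, 𝒩.IsFactor A X := hX
  rw [diagSq, dif_pos hX']
  exact sq_d_eq hX'.choose_spec i

/-- The choice of factor is immaterial because the pivots depend on `X` alone. -/
theorem diagSq_eq {A : 𝒩.TAlg} {X : 𝒩.herm} (h : 𝒩.IsFactor A X) (i : Fin m) :
    diagSq X i = A.d i ^ 2 := by
  rw [diagSq_eq_pivot ⟨A, h⟩, sq_d_eq h]

theorem piSq_eq {A : 𝒩.TAlg} {X : 𝒩.herm} (h : 𝒩.IsFactor A X) : piSq X = detG A ^ 2 := by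
  rw [piSq, detG, ← Finset.prod_pow]
  exact Finset.prod_congr rfl fun i _ => diagSq_eq h i

end Polynomials
-- Exponents and degrees in the triangular recursion.
section Products

variable {F : Type*} [Field F] {m : ℕ}

theorem prod_prod_Ioi {M : Type*} [CommMonoid M] (f : Fin m → Fin m → M) :
    ∏ i, ∏ s ∈ Finset.Ioi i, f i s = ∏ s, ∏ i ∈ Finset.Iio s, f i s :=
  Finset.prod_comm' (by simp)

/-- Each `x s` stands once in a numerator and in the denominators of the `s` indices below it. -/
theorem prod_div_prod_Ioi (x : Fin m → F) (hx : ∀ i, x i ≠ 0) :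
    ∏ i, x i / ∏ s ∈ Finset.Ioi i, x s = ∏ i, x i ^ (1 - ((i : ℕ) : ℤ)) := by
  rw [Finset.prod_div_distrib, prod_prod_Ioi, ← Finset.prod_div_distrib]
  refine Finset.prod_congr rfl fun i _ => ?_
  rw [Finset.prod_const, Fin.card_Iio, zpow_sub₀ (hx i), zpow_one, zpow_natCast]

theorem prod_zpow_one_sub [NeZero m] (x : Fin m → F) :
    ∏ i, x i ^ (1 - ((i : ℕ) : ℤ))
      = x 0 / ∏ l ∈ Finset.univ.filter (fun l : Fin m => 2 ≤ (l : ℕ)), x l ^ ((l : ℕ) - 1) := by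
  rw [Finset.prod_filter, div_eq_mul_inv, ← Finset.prod_inv_distrib]
  have h0 : x 0 = ∏ i, if i = 0 then x i else 1 := by simp
  rw [h0, ← Finset.prod_mul_distrib]
  refine Finset.prod_congr rfl fun i _ => ?_
  by_cases hi : i = 0
  · subst hi
    simp
  · have hi' : (i : ℕ) ≠ 0 := fun h => hi (Fin.ext (by simpa using h))
    rw [if_neg hi, one_mul]
    split_ifs with h2
    · have : (1 - ((i : ℕ) : ℤ)) = -(((i : ℕ) - 1 : ℕ) : ℤ) := by omega
      rw [this, zpow_neg, zpow_natCast]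
    · have : (1 - ((i : ℕ) : ℤ)) = 0 := by omega
      rw [this, zpow_zero, inv_one]

/-- Since `a i = r i / ∏_{s>i} r s`, the factor `r i` receives exponent `t i` from `a i` and `-t j`
from every `a j` with `j < i`. -/
theorem inv_prod_zpow (r a : Fin m → F) (hr : ∀ i, r i ≠ 0)
    (ha : ∀ i, r i = a i * ∏ s ∈ Finset.Ioi i, r s) (t : Fin m → ℤ) :
    (∏ i, a i ^ t i)⁻¹ = ∏ i, r i ^ (-(t i - ∑ j ∈ Finset.Iio i, t j)) := by
  have h : ∀ i, a i ^ t i = r i ^ t i / ∏ s ∈ Finset.Ioi i, r s ^ t i := by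
    intro i
    have hne : ∏ s ∈ Finset.Ioi i, r s ≠ 0 := Finset.prod_ne_zero_iff.2 fun s _ => hr s
    rw [Finset.prod_zpow, ← div_zpow]
    nth_rw 1 [ha i]
    rw [mul_div_cancel_right₀ _ hne]
  have hpow : ∀ i (s : Finset (Fin m)), ∏ j ∈ s, r i ^ t j = r i ^ ∑ j ∈ s, t j := by
    intro i s
    induction s using Finset.induction_on with
    | empty => simp
    | insert a s has ih => rw [Finset.prod_insert has, Finset.sum_insert has, ih, zpow_add₀ (hr i)]
  rw [Finset.prod_congr rfl fun i _ => h i, Finset.prod_div_distrib,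
    prod_prod_Ioi (f := fun i s => r s ^ t i), ← Finset.prod_div_distrib, ← Finset.prod_inv_distrib]
  refine Finset.prod_congr rfl fun i _ => ?_
  rw [hpow, zpow_neg, zpow_sub₀ (hr i)]

/-- The solution of the recursion `r i = a i * ∏ s > i, r s`. -/
def tailProd (a : Fin m → F) (i : Fin m) : F :=
  a i * ∏ s ∈ (Finset.Ioi i).attach, tailProd a s.1
termination_by m - (i : ℕ)
decreasing_by
  have h := Finset.mem_Ioi.1 s.2
  have := s.1.2
  rw [Fin.lt_def] at h
  omega

theorem tailProd_eq (a : Fin m → F) (i : Fin m) :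
    tailProd a i = a i * ∏ s ∈ Finset.Ioi i, tailProd a s := by
  rw [tailProd, Finset.prod_attach (Finset.Ioi i) fun s => tailProd a s]

theorem sum_two_pow_filter (t : ℕ) (ht : t ≤ m) :
    ∑ s ∈ Finset.univ.filter (fun s : Fin m => m - t ≤ (s : ℕ)), 2 ^ (m - 1 - (s : ℕ)) + 1 = 2 ^ t := by
  induction t with
  | zero =>
    rw [Finset.filter_false_of_mem fun s _ => by omega]
    simp
  | succ t ih =>
    let k : Fin m := ⟨m - (t + 1), by omega⟩
    have hk : m - t = (k : ℕ) + 1 := by simp only [k]; omega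
    have hkt : m - 1 - (k : ℕ) = t := by simp only [k]; omega
    have := ih (by omega)
    rw [hk] at this
    change ∑ s ∈ Finset.univ.filter (fun s : Fin m => (k : ℕ) ≤ (s : ℕ)), 2 ^ (m - 1 - (s : ℕ)) + 1 = _
    rw [filter_le_val_eq_insert, Finset.sum_insert (by simp), hkt, add_assoc, this, pow_succ, mul_two]

/-- This geometric sum says that the degree of `p i` exceeds the total degree of the later
polynomials by one, which makes `a_ii²` homogeneous of degree one. -/
theorem sum_two_pow_Ioi (i : Fin m) :
    ∑ s ∈ Finset.Ioi i, 2 ^ (m - 1 - (s : ℕ)) + 1 = 2 ^ (m - 1 - (i : ℕ)) := by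
  have hi := i.2
  rw [← sum_two_pow_filter _ (by omega : m - 1 - (i : ℕ) ≤ m)]
  congr 2
  ext s
  simp only [Finset.mem_filter, Finset.mem_univ, true_and, Finset.mem_Ioi, Fin.lt_def]
  omega

end Products

/-! ### Products of rational functions. -/

section RationalFunctions

variable {K : Type v} [RCLike K] {σ : Type w}

theorem isHomogeneousRat_prod {α : Type*} (s : Finset α) (f : α → RatFun σ K) (d : α → ℤ)
    (hf : ∀ i ∈ s, IsHomogeneousRat (f i) (d i)) : IsHomogeneousRat (∏ i ∈ s, f i) (∑ i ∈ s, d i) := by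
  classical
  induction s using Finset.induction_on with
  | empty =>
    exact ⟨1, 1, 0, 0, MvPolynomial.isHomogeneous_one _ _, MvPolynomial.isHomogeneous_one _ _,
      one_ne_zero, by simp, by simp⟩
  | insert i s hi ih =>
    obtain ⟨P, Q, a, b, hP, hQ, hQ0, hab, hPQ⟩ := hf i (Finset.mem_insert_self i s)
    obtain ⟨P', Q', a', b', hP', hQ', hQ0', hab', hPQ'⟩ :=
      ih fun j hj => hf j (Finset.mem_insert_of_mem hj)
    refine ⟨P * P', Q * Q', a + a', b + b', hP.mul hP', hQ.mul hQ', mul_ne_zero hQ0 hQ0', ?_, ?_⟩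
    · rw [Finset.sum_insert hi, ← hab, ← hab']
      push_cast
      ring
    · rw [Finset.prod_insert hi, hPQ, hPQ', map_mul, map_mul, div_mul_div_comm]

theorem hasValueAt_prod {α : Type*} (s : Finset α) (f : α → RatFun σ K) (x : σ → K) (c : α → K)
    (hf : ∀ i ∈ s, HasValueAt (f i) x (c i)) : HasValueAt (∏ i ∈ s, f i) x (∏ i ∈ s, c i) := by
  classical
  induction s using Finset.induction_on with
  | empty => exact ⟨1, 1, by simp, by simp, by simp⟩
  | insert i s hi ih =>
    obtain ⟨P, Q, hQ, hPQ, hc⟩ := hf i (Finset.mem_insert_self i s)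
    obtain ⟨P', Q', hQ', hPQ', hc'⟩ := ih fun j hj => hf j (Finset.mem_insert_of_mem hj)
    refine ⟨P * P', Q * Q', ?_, ?_, ?_⟩
    · rw [map_mul]
      exact mul_ne_zero hQ hQ'
    · rw [Finset.prod_insert hi, hPQ, hPQ', map_mul, map_mul, div_mul_div_comm]
    · rw [Finset.prod_insert hi, hc, hc', map_mul, map_mul, div_mul_div_comm]

end RationalFunctions

/-! ### Values of the characteristic function. -/

section CharacteristicFunction

variable {K : Type v} [RCLike K] {m : ℕ} {𝒩 : NilAlgebra.{u, v} K m}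

/-- Multiplying the columns of `A` by signs does not change `A · A*`. -/
theorem isFactor_of_sq_eq {A : 𝒩.TAlg} {X : 𝒩.herm} (h : 𝒩.IsFactor A X) (a : Fin m → K)
    (ha : ∀ i, a i ∈ unitComponent K) (hsq : ∀ i, a i ^ 2 = A.d i ^ 2) :
    ∃ A' : 𝒩.TAlg, 𝒩.IsFactor A' X ∧ ∀ i, A'.d i = a i := by
  have hne : ∀ i, A.d i ≠ 0 := fun i => (h.1.2 i).1
  let E : 𝒩.TAlg := (fun i => a i / A.d i, 0, 0)
  have hE : E ∈ 𝒩.G := ⟨fun _ _ => rfl, fun i => by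
    change a i / A.d i ∈ _
    rw [div_eq_mul_inv]
    exact mul_mem_unitComponent (ha i) (inv_mem_unitComponent (h.1.2 i))⟩
  have hEE : 𝒩.tmul E (𝒩.adj E) = 𝒩.one := by
    refine herm_ext (tmul_adj_self_mem_herm E) adj_one (fun i => ?_) fun i j => ?_
    · rw [d_tmul_adj _ _ hE.1 hE.1]
      simp only [E, TAlg.d_mk, TAlg.u_mk, Pi.zero_apply, map_zero, Finset.sum_const_zero, add_zero]
      rw [← sq, div_pow, hsq, div_self (pow_ne_zero 2 (hne i))]
      rfl
    · rw [u_tmul_adj _ _ hE.1 hE.1]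
      simp [E, mulFlat_zero_left, one]
  -- Both `(A E)(A E)*` and `A A*` equal `ρ_A` of the identity matrix. The detour through the action
  -- avoids associativity in products with adjoints.
  have h1 := action_tmul_adj_self A E h.1.1 hE.1 ⟨𝒩.one, adj_one⟩ hEE.symm
  have h2 := action_tmul_adj_self A 𝒩.one h.1.1 one_mem_solv ⟨𝒩.one, adj_one⟩
    (by rw [adj_one, tmul_one])
  rw [h1, tmul_one, ← h.2] at h2
  refine ⟨𝒩.tmul A E, ⟨tmul_mem_G h.1 hE, h2.symm⟩, fun i => ?_⟩
  rw [d_tmul _ _ h.1.1 hE.1]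
  exact mul_div_cancel₀ _ (hne i)

/-- The recursion `r_i = a_ii ∏_{s>i} r_s` matches the diagonals of factors of `X` with systems of
square roots of the pivots, and `inv_prod_zpow` converts the exponents. -/
theorem charValues_eq {X : 𝒩.herm} (hX : X ∈ 𝒩.cone) : charValues X =
    {c | ∃ r : Fin m → K, (∀ i, r i ∈ unitComponent K ∧ r i ^ 2 = pivot (X : 𝒩.TAlg) i) ∧
      c = ∏ i, r i ^ (-(𝒩.twoN i - ∑ j ∈ Finset.Iio i, 𝒩.twoN j))} := by
  ext c
  constructor
  · rintro ⟨A, hA, rfl⟩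
    have hr : ∀ i, tailProd A.d i ∈ unitComponent K ∧ tailProd A.d i ^ 2 = pivot (X : 𝒩.TAlg) i := by
      intro i
      induction i using strong_induction_Ioi with
      | h i ih =>
        rw [tailProd_eq]
        refine ⟨mul_mem_unitComponent (hA.1.2 i)
          (prod_mem_unitComponent _ _ fun s hs => (ih s hs).1), ?_⟩
        rw [mul_pow, ← Finset.prod_pow, Finset.prod_congr rfl fun s hs => (ih s hs).2, pivot_eq hA i,
          mul_comm]
    refine ⟨tailProd A.d, hr, ?_⟩
    rw [det_action hA.1]
    exact inv_prod_zpow _ _ (fun i => (hr i).1.1) (tailProd_eq A.d) _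
  · rintro ⟨r, hr, rfl⟩
    obtain ⟨A, hA⟩ := hX
    have hprod : ∀ i, ∏ s ∈ Finset.Ioi i, r s ∈ unitComponent K := fun i =>
      prod_mem_unitComponent _ _ fun s _ => (hr s).1
    -- The diagonal forced by the recursion has the same squares as that of `A`, so sign changes of
    -- the columns realize it.
    obtain ⟨A', hA', hd⟩ := isFactor_of_sq_eq hA (fun i => r i / ∏ s ∈ Finset.Ioi i, r s)
      (fun i => by
        rw [div_eq_mul_inv]
        exact mul_mem_unitComponent (hr i).1 (inv_mem_unitComponent (hprod i)))
      (fun i => by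
        rw [sq_d_eq hA i, div_pow, (hr i).2, ← Finset.prod_pow,
          Finset.prod_congr rfl fun s _ => (hr s).2])
    refine ⟨A', hA', ?_⟩
    rw [det_action hA'.1]
    refine (inv_prod_zpow _ _ (fun i => (hr i).1.1) (fun i => ?_) _).symm
    rw [hd, div_mul_cancel₀ _ (hprod i).1]

theorem eq_ofReal_re (hI : (RCLike.I : K) = 0) (z : K) : z = ((RCLike.re z : ℝ) : K) := by
  conv_lhs => rw [← RCLike.re_add_im z, hI, mul_zero, add_zero]

/-- Over the reals each `r i` must be the positive root, so real powers of the pivot `ρ²` agree with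
integral powers of `ρ` of twice the exponent. -/
theorem charValues_eq_singleton (hI : (RCLike.I : K) = 0) {X : 𝒩.herm} (hX : X ∈ 𝒩.cone) :
    charValues X = {((∏ i, RCLike.re (pivot (X : 𝒩.TAlg) i) ^
      (-(𝒩.n i - ∑ j ∈ Finset.Iio i, 𝒩.n j)) : ℝ) : K)} := by
  have hne : (charValues X).Nonempty := by
    obtain ⟨A, hA⟩ := hX
    exact ⟨_, A, hA, rfl⟩
  refine Set.eq_singleton_iff_nonempty_unique_mem.2 ⟨hne, fun c hc => ?_⟩
  rw [charValues_eq hX] at hc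
  obtain ⟨r, hr, rfl⟩ := hc
  rw [RCLike.ofReal_prod]
  refine Finset.prod_congr rfl fun i _ => ?_
  set ρ := RCLike.re (r i) with hρ
  have hpos : 0 < ρ := (hr i).1.2 hI
  have hri : r i = (ρ : K) := eq_ofReal_re hI (r i)
  have hp : RCLike.re (pivot (X : 𝒩.TAlg) i) = ρ ^ (2 : ℝ) := by
    rw [← (hr i).2, hri, ← RCLike.ofReal_pow, RCLike.ofReal_re, Real.rpow_two]
  have hexp : (2 : ℝ) * (-(𝒩.n i - ∑ j ∈ Finset.Iio i, 𝒩.n j))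
      = ((-(𝒩.twoN i - ∑ j ∈ Finset.Iio i, 𝒩.twoN j) : ℤ) : ℝ) := by
    push_cast
    simp only [twoN_eq, ← Finset.mul_sum]
    ring
  rw [hp, ← Real.rpow_mul hpos.le, hexp, Real.rpow_intCast, hri, RCLike.ofReal_zpow]

end CharacteristicFunction
end NilAlgebra

/-! ### The lemma. -/

open NilAlgebra MvPolynomial in
theorem lemma3p1 {K : Type*} [RCLike K] {m : ℕ} [NeZero m] (𝒩 : NilAlgebra K m)
    {ι : Fin m → Fin m → Type*} (b : ∀ i j, Module.Basis (ι i j) K (𝒩.N i j)) :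
    -- `ρ` is the representation of `G` on `Herm` that integrates `L`
    𝒩.IntegratesLieAction action ∧
    -- the functions `a_{ii}(X)²` are globally defined and invariant under `G'`
    (∀ A X, 𝒩.IsFactor A X → ∀ i, diagSq X i = A.d i ^ 2) ∧
    (∀ A ∈ 𝒩.G', ∀ X ∈ 𝒩.cone, action A X ∈ 𝒩.cone ∧
      ∀ i, diagSq (action A X) i = diagSq X i) ∧
    -- the polynomials `p i`, numbered by `0, …, m - 1` instead of `1, …, m`
    ∃ p : Fin m → MvPolynomial (CoordIndex ι) K,
      (∀ i, (p i).IsHomogeneous (2 ^ (m - 1 - (i : ℕ)))) ∧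
      (∀ X ∈ 𝒩.cone, ∀ i, eval (coords b X) (p i) ≠ 0 ∧
        diagSq X i = eval (coords b X) (p i) / ∏ s ∈ Finset.Ioi i, eval (coords b X) (p s)) ∧
      -- `a_{ii}²` is a homogeneous rational function of degree `1`
      (∀ i, ∃ f : RatFun (CoordIndex ι) K,
        f = algebraMap _ _ (p i) / ∏ s ∈ Finset.Ioi i, algebraMap _ _ (p s) ∧
        IsHomogeneousRat f 1 ∧ ∀ X ∈ 𝒩.cone, HasValueAt f (coords b X) (diagSq X i)) ∧
      -- (i) the squared `G`-determinant
      ((∀ A ∈ 𝒩.G₀, ∀ X ∈ 𝒩.cone, action A X ∈ 𝒩.cone ∧ piSq (action A X) = piSq X) ∧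
        (∀ A X, 𝒩.IsFactor A X → piSq X = detG A ^ 2) ∧
        (∀ X ∈ 𝒩.cone,
          piSq X = ∏ i : Fin m, eval (coords b X) (p i) ^ (1 - (i : ℤ)) ∧
          piSq X = eval (coords b X) (p 0) /
            ∏ l ∈ Finset.univ.filter (fun l : Fin m => 2 ≤ (l : ℕ)), eval (coords b X) (p l) ^ ((l : ℕ) - 1)) ∧
        ∃ f : RatFun (CoordIndex ι) K,
          f = ∏ i : Fin m, algebraMap _ (RatFun (CoordIndex ι) K) (p i) ^ (1 - (i : ℤ)) ∧
          f = algebraMap _ _ (p 0) /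
            ∏ l ∈ Finset.univ.filter (fun l : Fin m => 2 ≤ (l : ℕ)), algebraMap _ _ (p l) ^ ((l : ℕ) - 1) ∧
          IsHomogeneousRat f m ∧ ∀ X ∈ 𝒩.cone, HasValueAt f (coords b X) (piSq X)) ∧
      -- (ii) the characteristic function; real powers if `K = ℝ`
      ((RCLike.I : K) = 0 → ∀ X ∈ 𝒩.cone,
        (∀ i, 0 < RCLike.re (eval (coords b X) (p i))) ∧
        charValues X = {((∏ i, RCLike.re (eval (coords b X) (p i)) ^
          (-(𝒩.n i - ∑ j ∈ Finset.Iio i, 𝒩.n j)) : ℝ) : K)}) ∧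
      -- in general, half-integral powers are integral powers of the square roots of `p i (X)`
      ∀ X ∈ 𝒩.cone, charValues X =
        {c | ∃ r : Fin m → K,
          (∀ i, r i ∈ unitComponent K ∧ r i ^ 2 = eval (coords b X) (p i)) ∧
          c = ∏ i, r i ^ (-(𝒩.twoN i - ∑ j ∈ Finset.Iio i, 𝒩.twoN j))} := by
  choose p hp hpe using fun i => isPolyMap_pivot (b := b) i
  have hne : ∀ X ∈ 𝒩.cone, ∀ i, eval (coords b X) (p i) ≠ 0 := by
    rintro X ⟨A, hA⟩ i
    rw [hpe]
    exact (pivot_mem_unitComponent hA i).1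
  -- One point of the cone is enough to see that the `p i` are nonzero polynomials, as division in
  -- the function field requires.
  have hone : (⟨𝒩.one, adj_one⟩ : 𝒩.herm) ∈ 𝒩.cone :=
    ⟨𝒩.one, one_mem_G, by rw [adj_one, tmul_one]⟩
  have hp0 : ∀ i, p i ≠ 0 := fun i h => hne _ hone i (by rw [h, map_zero])
  have hq0 : ∀ i, algebraMap _ (RatFun (CoordIndex ι) K) (p i) ≠ 0 := fun i =>
    (map_ne_zero_iff _ (IsFractionRing.injective _ _)).2 (hp0 i)
  have hdiag : ∀ X ∈ 𝒩.cone, ∀ i, diagSq X i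
      = eval (coords b X) (p i) / ∏ s ∈ Finset.Ioi i, eval (coords b X) (p s) := by
    intro X hX i
    simp only [hpe]
    exact diagSq_eq_pivot hX i
  have hhom : ∀ i, IsHomogeneousRat (algebraMap _ (RatFun (CoordIndex ι) K) (p i)
      / ∏ s ∈ Finset.Ioi i, algebraMap _ _ (p s)) 1 := by
    intro i
    refine ⟨p i, ∏ s ∈ Finset.Ioi i, p s, _, _, hp i,
      MvPolynomial.IsHomogeneous.prod _ _ _ fun s _ => hp s,
      Finset.prod_ne_zero_iff.2 fun s _ => hp0 s, ?_, by rw [map_prod]⟩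
    rw [← sum_two_pow_Ioi i]
    push_cast
    ring
  have hval : ∀ i, ∀ X ∈ 𝒩.cone, HasValueAt (algebraMap _ (RatFun (CoordIndex ι) K) (p i)
      / ∏ s ∈ Finset.Ioi i, algebraMap _ _ (p s)) (coords b X) (diagSq X i) := by
    intro i X hX
    refine ⟨p i, ∏ s ∈ Finset.Ioi i, p s, ?_, by rw [map_prod], by rw [map_prod, hdiag X hX]⟩
    rw [map_prod]
    exact Finset.prod_ne_zero_iff.2 fun s _ => hne X hX s
  have hpi : ∀ X ∈ 𝒩.cone, piSq X = ∏ i : Fin m, eval (coords b X) (p i) ^ (1 - (i : ℤ)) := by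
    intro X hX
    rw [piSq, Finset.prod_congr rfl fun i _ => hdiag X hX i]
    exact prod_div_prod_Ioi (fun i => eval (coords b X) (p i)) (hne X hX)
  refine ⟨integratesLieAction_action, fun A X h i => diagSq_eq h i, ?_, p, hp,
    fun X hX i => ⟨hne X hX i, hdiag X hX i⟩, fun i => ⟨_, rfl, hhom i, hval i⟩,
    ⟨?_, fun A X h => piSq_eq h, fun X hX => ⟨hpi X hX, ?_⟩, _, rfl, ?_, ?_, ?_⟩, ?_, ?_⟩
  · rintro A hA X ⟨B, hB⟩
    have hAB := isFactor_action hA.1 hB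
    refine ⟨⟨_, hAB⟩, fun i => ?_⟩
    rw [diagSq_eq hAB, diagSq_eq hB, d_tmul _ _ hA.1.1 hB.1.1, hA.2, one_mul]
  · rintro A hA X ⟨B, hB⟩
    have hAB := isFactor_action hA.1 hB
    have hdet : detG (𝒩.tmul A B) = detG A * detG B := by
      simp only [detG, d_tmul _ _ hA.1.1 hB.1.1, Finset.prod_mul_distrib]
    refine ⟨⟨_, hAB⟩, ?_⟩
    rw [piSq_eq hAB, piSq_eq hB, hdet, hA.2, one_mul]
  · rw [hpi X hX]
    exact prod_zpow_one_sub fun i => eval (coords b X) (p i)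
  · exact prod_zpow_one_sub fun i => algebraMap _ (RatFun (CoordIndex ι) K) (p i)
  -- As a rational function `π²` is the product of the `m` functions `a_ii²`, each homogeneous of
  -- degree one.
  · rw [← prod_div_prod_Ioi (fun i => algebraMap _ (RatFun (CoordIndex ι) K) (p i)) hq0]
    simpa using isHomogeneousRat_prod Finset.univ _ _ fun i _ => hhom i
  · intro X hX
    rw [← prod_div_prod_Ioi (fun i => algebraMap _ (RatFun (CoordIndex ι) K) (p i)) hq0]
    exact hasValueAt_prod Finset.univ _ _ _ fun i _ => hval i X hX
  · intro hI X hX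
    simp only [hpe]
    refine ⟨fun i => ?_, charValues_eq_singleton hI hX⟩
    obtain ⟨A, hA⟩ := hX
    exact (pivot_mem_unitComponent hA i).2 hI
  · intro X hX
    simp only [hpe]
    exact charValues_eq hX
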